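/- Let $A$ be a finite totally ordered set (of letters) and let $\mathbb K$ be a field of characteristic $0$. A column on $A$ is a subset of $A$, identified with the word obtained by multiplying its letters in decreasing order; let $\Gamma(A)$ be the set of columns. For $a\in A$ and $\gamma\in\Gamma(A)$, let $a\cdot\gamma$ be the column obtained from $\gamma$ by replacing the smallest letter of $\gamma$ that is $\geq a$ by $a$, or by adding $a$ to $\gamma$ if there is no such letter. This defines a left action of the free monoid $A^*$ on $\Gamma(A)$; the stylic monoid $\mathrm{Styl}(A)$ is the monoid of the endofunctions $\gamma\mapsto w\cdot\gamma$ of $\Gamma(A)$, $w\in A^*$, and $\mathbb K\mathrm{Styl}(A)$ is its monoid algebra. Write $u\equiv_{styl}v$ if the words $u,v$ have the same image in $\mathrm{Styl}(A)$. For $\gamma\in\Gamma(A)$ put $$e_\gamma=\prod^{\nearrow}_{a\notin\gamma}(1-a)\ \prod^{\searrow}_{a\in\gamma}a\ \in\ \mathbb K\mathrm{Styl}(A),$$ where the first product is taken in increasing and the second in decreasing order of the letters. For $\gamma\in\Gamma(A)$ and $c\in A$, let $\gamma\cdot c$ be the column obtained from $\gamma$ by replacing the largest letter of $\gamma$ that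 is $\leq c$ by $c$, or by adding $c$ to $\gamma$ if there is no such letter. The right action of $c$ on $\gamma$ is called frank if $\gamma\ne\emptyset$, $c\geq\min(\gamma)$ and $c\notin\gamma$. Let $Q(A)$ be the quiver whose vertices are the columns on $A$, with one arrow $\gamma\xrightarrow{c}\gamma\cdot c$ for each $\gamma\in\Gamma(A)$ and each $c\in A$ whose right action on $\gamma$ is frank. The label of a path is the product of the labels of its arrows; in the path algebra $\mathbb KQ(A)$ paths are multiplied from left to right. Then the quiver of the finite-dimensional algebra $\Lambda=\mathbb K\mathrm{Styl}(A)$ is $Q(A)$. That is, with $J$ the Jacobson radical of $\Lambda$: $\Lambda/J\cong\mathbb K^{\Gamma(A)}$ as $\mathbb K$-algebras; the elements $e_\gamma$, $\gamma\in\Gamma(A)$, form a complete system of primitive orthogonal idempotents of $\Lambda$; and, for all columns $\gamma,\delta$, the dimension of $e_\gamma(J/J^2)e_\delta$ is the number of arrows from $\gamma$ to $\delta$ in $Q(A)$. Moreover, there is a homomorphism of $\mathbb K$-algebras $\varphi:\mathbb KQ(A)\to\mathbb K\mathrm{Styl}(A)$ that maps each path $\gamma_0\xrightarrow{c_1}\gamma_1\xrightarrow{c_2}\cdots\xrightarrow{c_l}\gamma_l$,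 $l\ge0$, to $e_{\gamma_0}c_1e_{\gamma_1}c_2\cdots c_le_{\gamma_l}$. It is surjective, and its kernel is an admissible ideal: $F^m\subseteq\ker\varphi\subseteq F^2$ for some $m\geq2$, where $F$ is the ideal of $\mathbb KQ(A)$ generated by the arrows. The kernel is spanned by the differences of two paths of $Q(A)$ that start at the same vertex $\gamma$ and have labels $u,v$ with $\gamma u\equiv_{styl}\gamma v$. -/

import Mathlib

/-! ### Path algebras of finite quivers -/

/-- All paths of a quiver, including the empty path at each vertex. -/
abbrev QuiverPath (V : Type*) [Quiver V] : Type _ := Σ a : V, Σ b : V, Quiver.Path a b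

/-- The path algebra: the free `K`-module on the set of all paths. -/
def PathAlgebra (K : Type*) [Field K] (V : Type*) [Quiver V] : Type _ := QuiverPath V →₀ K

namespace PathAlgebra

variable {K : Type*} [Field K] {V : Type*} [Quiver V]

noncomputable instance : AddCommGroup (PathAlgebra K V) :=
  inferInstanceAs (AddCommGroup (QuiverPath V →₀ K))

noncomputable instance : Module K (PathAlgebra K V) :=
  inferInstanceAs (Module K (QuiverPath V →₀ K))

/-- The basis of the path algebra formed by the paths. -/
noncomputable def basis (K : Type*) [Field K] (V : Type*) [Quiver V] :
    Module.Basis (QuiverPath V) K (PathAlgebra K V) :=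
  Module.Basis.ofRepr (LinearEquiv.refl K (QuiverPath V →₀ K))

/-- A path, as an element of the path algebra. -/
noncomputable def ofPath (K : Type*) [Field K] {V : Type*} [Quiver V] {a b : V}
    (p : Quiver.Path a b) : PathAlgebra K V :=
  basis K V ⟨a, b, p⟩

open Classical in
/-- The product of two paths: first `p`, then `q`, if `q` starts where `p` ends; and `0` otherwise. -/
noncomputable def pathMul (p q : QuiverPath V) : PathAlgebra K V :=
  if h : p.2.1 = q.1 then ofPath K (p.2.2.comp (q.2.2.cast h.symm rfl)) else 0

/-- The bilinear extension of the product of paths. -/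
noncomputable def mulLin : PathAlgebra K V →ₗ[K] PathAlgebra K V →ₗ[K] PathAlgebra K V :=
  (basis K V).constr K fun p => (basis K V).constr K fun q => pathMul p q

noncomputable instance : Mul (PathAlgebra K V) := ⟨fun x y => mulLin x y⟩

/-- The unit is the sum of the empty paths. -/
noncomputable instance [Fintype V] : One (PathAlgebra K V) :=
  ⟨∑ v : V, ofPath K (Quiver.Path.nil : Quiver.Path v v)⟩

theorem mul_def (x y : PathAlgebra K V) : x * y = mulLin x y := rfl

theorem one_def [Fintype V] :
    (1 : PathAlgebra K V) = ∑ v : V, ofPath K (Quiver.Path.nil : Quiver.Path v v) := rfl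

theorem mulLin_ofPath {a b c d : V} (p : Quiver.Path a b) (q : Quiver.Path c d) :
    mulLin (ofPath K p) (ofPath K q) = pathMul ⟨a, b, p⟩ ⟨c, d, q⟩ := by
  simp [mulLin, ofPath, Module.Basis.constr_basis]

theorem mulLin_ofPath_comp {a b c : V} (p : Quiver.Path a b) (q : Quiver.Path b c) :
    mulLin (ofPath K p) (ofPath K q) = ofPath K (p.comp q) := by
  rw [mulLin_ofPath]
  simp [pathMul]

theorem mulLin_ofPath_of_ne {a b c d : V} (p : Quiver.Path a b) (q : Quiver.Path c d)
    (h : b ≠ c) : mulLin (ofPath K p) (ofPath K q) = 0 := by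
  rw [mulLin_ofPath]
  simp [pathMul, h]

theorem path_induction {P : PathAlgebra K V → Prop} (x : PathAlgebra K V) (zero : P 0)
    (add : ∀ x y, P x → P y → P (x + y))
    (path : ∀ (r : K) (a b : V) (p : Quiver.Path a b), P (r • ofPath K p)) : P x := by
  rw [← (basis K V).linearCombination_repr x, Finsupp.linearCombination_apply]
  exact Finset.sum_induction _ P add zero fun p _ => path _ p.1 p.2.1 p.2.2

theorem mulLin_assoc (x y z : PathAlgebra K V) :
    mulLin (mulLin x y) z = mulLin x (mulLin y z) := by
  refine path_induction
    (P := fun x => mulLin (mulLin x y) z = mulLin x (mulLin y z)) x (by simp)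
    (fun _ _ h₁ h₂ => by simp only [map_add, LinearMap.add_apply, h₁, h₂]) fun r a b p => ?_
  refine path_induction
    (P := fun y => mulLin (mulLin _ y) z = mulLin _ (mulLin y z)) y (by simp)
    (fun _ _ h₁ h₂ => by simp only [map_add, LinearMap.add_apply, h₁, h₂]) fun s c d q => ?_
  refine path_induction
    (P := fun z => mulLin (mulLin _ _) z = mulLin _ (mulLin _ z)) z (by simp)
    (fun _ _ h₁ h₂ => by simp only [map_add, h₁, h₂]) fun t e f u => ?_
  suffices h : mulLin (mulLin (ofPath K p) (ofPath K q)) (ofPath K u) =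
      mulLin (ofPath K p) (mulLin (ofPath K q) (ofPath K u)) by
    simp only [map_smul, LinearMap.smul_apply, h]
  by_cases h : b = c
  · subst h
    rw [mulLin_ofPath_comp]
    by_cases h' : d = e
    · subst h'
      rw [mulLin_ofPath_comp, mulLin_ofPath_comp, mulLin_ofPath_comp, Quiver.Path.comp_assoc]
    · rw [mulLin_ofPath_of_ne _ _ h', mulLin_ofPath_of_ne _ _ h', map_zero]
  · rw [mulLin_ofPath_of_ne _ _ h, map_zero, LinearMap.zero_apply]
    by_cases h' : d = e
    · subst h'
      rw [mulLin_ofPath_comp, mulLin_ofPath_of_ne _ _ h]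
    · rw [mulLin_ofPath_of_ne _ _ h', map_zero]

theorem mulLin_one_left [Fintype V] (x : PathAlgebra K V) : mulLin 1 x = x := by
  refine path_induction
    (P := fun x => mulLin 1 x = x) x (by simp) (fun _ _ h₁ h₂ => by simp [h₁, h₂]) fun r a b p => ?_
  rw [map_smul, one_def, map_sum, LinearMap.sum_apply, Finset.sum_eq_single a
    (fun v _ hv => mulLin_ofPath_of_ne _ _ hv) (fun h => absurd (Finset.mem_univ a) h),
    mulLin_ofPath_comp, Quiver.Path.nil_comp]

theorem mulLin_one_right [Fintype V] (x : PathAlgebra K V) : mulLin x 1 = x := by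
  refine path_induction
    (P := fun x => mulLin x 1 = x) x (by simp) (fun _ _ h₁ h₂ => by simp [h₁, h₂]) fun r a b p => ?_
  rw [map_smul, LinearMap.smul_apply, one_def, map_sum, Finset.sum_eq_single b
    (fun v _ hv => mulLin_ofPath_of_ne _ _ (Ne.symm hv)) (fun h => absurd (Finset.mem_univ b) h),
    mulLin_ofPath_comp, Quiver.Path.comp_nil]

noncomputable instance [Fintype V] : Ring (PathAlgebra K V) :=
  { (inferInstance : AddCommGroup (PathAlgebra K V)),
    (inferInstance : Mul (PathAlgebra K V)),
    (inferInstance : One (PathAlgebra K V)) with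
    left_distrib := fun x y z => by simp only [mul_def, map_add]
    right_distrib := fun x y z => by simp only [mul_def, map_add, LinearMap.add_apply]
    zero_mul := fun x => by simp only [mul_def, map_zero, LinearMap.zero_apply]
    mul_zero := fun x => by simp only [mul_def, map_zero]
    mul_assoc := mulLin_assoc
    one_mul := mulLin_one_left
    mul_one := mulLin_one_right }

noncomputable instance [Fintype V] : Algebra K (PathAlgebra K V) :=
  Algebra.ofModule
    (fun r x y => by
      change mulLin (r • x) y = r • mulLin x y
      rw [map_smul, LinearMap.smul_apply])
    (fun r x y => by
      change mulLin x (r • y) = r • mulLin x y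
      rw [map_smul])

/-- The two-sided ideal generated by the arrows. -/
noncomputable def arrowIdeal (K : Type*) [Field K] (V : Type*) [Quiver V] [Fintype V] :
    TwoSidedIdeal (PathAlgebra K V) :=
  TwoSidedIdeal.span {x | ∃ (a b : V) (f : a ⟶ b), x = ofPath K f.toPath}

end PathAlgebra

/-- A two-sided ideal of a `K`-algebra, as a `K`-subspace. -/
def TwoSidedIdeal.toSubspace (K : Type*) [Field K] {R : Type*} [Ring R] [Algebra K R]
    (I : TwoSidedIdeal R) : Submodule K R :=
  (TwoSidedIdeal.asIdeal I).restrictScalars K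

/-- An ideal `I` of a path algebra is admissible if `F ^ m ⊆ I ⊆ F ^ 2` for some `m ≥ 2`, where `F`
is the ideal generated by the arrows. The power `F ^ m` is the span of the products of `m` elements
of `F`. -/
def IsAdmissible {K : Type*} [Field K] {V : Type*} [Quiver V] [Fintype V]
    (I : TwoSidedIdeal (PathAlgebra K V)) : Prop :=
  (∃ m : ℕ, 2 ≤ m ∧ (PathAlgebra.arrowIdeal K V).toSubspace K ^ m ≤ I.toSubspace K) ∧
    I.toSubspace K ≤ (PathAlgebra.arrowIdeal K V).toSubspace K ^ 2

/-! ### The quiver of a finite-dimensional algebra -/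

section OrdinaryQuiver

/-- A primitive idempotent: a nonzero idempotent that is not the sum of two nonzero orthogonal
idempotents. -/
def IsPrimitiveIdempotent {R : Type*} [Ring R] (e : R) : Prop :=
  IsIdempotentElem e ∧ e ≠ 0 ∧
    ∀ x y : R, IsIdempotentElem x → IsIdempotentElem y → x * y = 0 → y * x = 0 → e = x + y →
      x = 0 ∨ y = 0

variable (K : Type*) [Field K] {R : Type*} [Ring R] [Algebra K R]

/-- The Jacobson radical of a `K`-algebra, as a `K`-subspace. -/
def radSubspace (R : Type*) [Ring R] [Algebra K R] : Submodule K R :=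
  (Ring.jacobson R).restrictScalars K

/-- `e (J / J ^ 2) f`, as a subspace of `R / J ^ 2`, where `J` is the Jacobson radical of `R`. -/
def arrowSpace (e f : R) : Submodule K (R ⧸ radSubspace K R ^ 2) :=
  ((radSubspace K R).map (LinearMap.mulLeft K e ∘ₗ LinearMap.mulRight K f)).map
    (radSubspace K R ^ 2).mkQ

/-- `V` is the (ordinary) quiver of the finite-dimensional elementary `K`-algebra `R`, with the
vertex `v` standing for the idempotent `e v`: modulo its radical `J`, the algebra `R` is a product
of copies of `K`; the `e v` form a complete system of primitive orthogonal idempotents; and, for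
all `v` and `w`, the number of arrows `v ⟶ w` is the dimension of `e v (J / J ^ 2) e w`. -/
structure IsOrdinaryQuiver (R : Type*) [Ring R] [Algebra K R] (V : Type*) [Quiver V] [Fintype V]
    (e : V → R) : Prop where
  finiteDimensional : Module.Finite K R
  elementary : Nonempty ((R ⧸ Ring.jacobson R) ≃ₐ[K] (V → K))
  complete : CompleteOrthogonalIdempotents e
  primitive : ∀ v, IsPrimitiveIdempotent (e v)
  finite_arrows : ∀ v w : V, Finite (v ⟶ w)
  card_arrows : ∀ v w : V, Module.finrank K (arrowSpace K (e v) (e w)) = Nat.card (v ⟶ w)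

end OrdinaryQuiver

/-! ### The stylic monoid and its algebra -/

/-- A column on `A`, identified with its set of letters. -/
abbrev Column (A : Type*) : Type _ := Finset A

section Stylic

variable {A : Type*} [LinearOrder A]

/-- Column insertion `a · γ`: the smallest letter of `γ` that is `≥ a`, if there is one, is replaced
by `a`; otherwise `a` is added. -/
def leftInsert (a : A) (γ : Column A) : Column A :=
  if h : (γ.filter (a ≤ ·)).Nonempty then insert a (γ.erase ((γ.filter (a ≤ ·)).min' h))
  else insert a γ

/-- The right action `γ · c`: the largest letter of `γ` that is `≤ c`, if there is one, is replaced
by `c`; otherwise `c` is added. -/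
def rightInsert (γ : Column A) (c : A) : Column A :=
  if h : (γ.filter (· ≤ c)).Nonempty then insert c (γ.erase ((γ.filter (· ≤ c)).max' h))
  else insert c γ

/-- The right action of `c` on `γ` is frank if `c ≥ min γ` (in particular `γ` is not empty) and
`c ∉ γ`. -/
def IsFrank (γ : Column A) (c : A) : Prop := (∃ x ∈ γ, x ≤ c) ∧ c ∉ γ

/-- The left action of words on columns, `(u v) · γ = u · (v · γ)`. -/
def columnAction (A : Type*) [LinearOrder A] : FreeMonoid A →* Function.End (Column A) :=
  FreeMonoid.lift fun a => (leftInsert a : Function.End (Column A))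

/-- The stylic monoid: the endofunctions of the set of columns given by the action of words. -/
abbrev Styl (A : Type*) [LinearOrder A] : Type _ := MonoidHom.mrange (columnAction A)

/-- The canonical morphism from words to the stylic monoid. -/
def toStyl : FreeMonoid A →* Styl A := (columnAction A).mrangeRestrict

/-- The stylic algebra over `K`. -/
abbrev StylAlgebra (K : Type*) [Field K] (A : Type*) [LinearOrder A] : Type _ :=
  MonoidAlgebra K (Styl A)

/-- A letter, as an element of the stylic algebra. -/
noncomputable def stylLetter (K : Type*) [Field K] (a : A) : StylAlgebra K A :=
  MonoidAlgebra.of K (Styl A) (toStyl (FreeMonoid.of a))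

/-- A column as a word: the product of its letters in decreasing order. -/
def columnWord (γ : Column A) : FreeMonoid A := FreeMonoid.ofList (γ.sort (· ≥ ·))

/-- The idempotent `e γ`: the product of the `1 - a` for `a ∉ γ` in increasing order of letters,
times the product of the `a ∈ γ` in decreasing order. -/
noncomputable def columnIdem (K : Type*) [Field K] [Fintype A] (γ : Column A) : StylAlgebra K A :=
  (((γᶜ).sort (· ≤ ·)).map fun a => 1 - stylLetter K a).prod *
    ((γ.sort (· ≥ ·)).map fun a => stylLetter K a).prod

/-! ### The quiver `Q(A)` -/

/-- The vertices of `Q(A)`: the columns on `A`. (A copy of the type of columns, which keeps the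
arrows below apart from those that come from the order by inclusion.) -/
def StylicQuiver (A : Type*) : Type _ := Column A

instance [Fintype A] : Fintype (StylicQuiver A) := inferInstanceAs (Fintype (Finset A))

/-- The arrows `γ ⟶ δ` of `Q(A)` are the letters `c` with `γ · c = δ` whose right action on `γ` is
frank. -/
instance : Quiver (StylicQuiver A) where
  Hom γ δ := {c : A // IsFrank (γ : Column A) c ∧ rightInsert (γ : Column A) c = δ}

/-- The label of an arrow. -/
def arrowLabel {γ δ : StylicQuiver A} (f : γ ⟶ δ) : A := f.1

/-- The label of a path: the product of the labels of its arrows. -/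
def pathLabel {γ : StylicQuiver A} : ∀ {δ : StylicQuiver A}, Quiver.Path γ δ → FreeMonoid A
  | _, .nil => 1
  | _, .cons p f => pathLabel p * FreeMonoid.of (arrowLabel f)

/-- For a path with vertices `γ₀, …, γₗ` and labels `c₁, …, cₗ`, the element
`e γ₀ * c₁ * e γ₁ * c₂ * ⋯ * cₗ * e γₗ` of the stylic algebra. -/
noncomputable def pathValue (K : Type*) [Field K] [Fintype A] {γ : StylicQuiver A} :
    ∀ {δ : StylicQuiver A}, Quiver.Path γ δ → StylAlgebra K A
  | _, .nil => columnIdem K γ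
  | δ, .cons p f => pathValue K p * stylLetter K (arrowLabel f) * columnIdem K δ

end Stylic

/-! Two facts about columns carry the proof. First, `leftInsert a` strictly raises `Column.weight`
unless `a` already lies in the column, so the action is triangular and a product fixes a column only
if each factor does (`Styl.act_mul_eq_self_iff`). Second, insertion is a max-plus map on the numbers
of letters in lower sets, which yields the plactic relations in `Styl A`. Hence every `z` is left
divisible by its first column `act z ∅`, and a frank letter commutes past a column: `γ c = d (γ·c)`
with `d·(γ·c) = γ` (`Styl.exists_of_isFrank`).

The product of the `1 - a` in `e γ` kills every element whose first column contains a letter outside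
`γ`, and does not alter the part with first column `γ`. So `e γ * z` depends only on `γ z`; it
vanishes unless `γ z` has first column `γ`, and then `γ z` can be read off from it. With
triangularity this makes the `e γ` orthogonal idempotents. On the right, a letter `c` of `γ` fixes
`e γ`, a letter smaller than all of `γ` kills it, and a frank one satisfies `e γ * c = e γ * c * e
(γ·c)`.

Consequently the path values span the stylic algebra, the value of a path from `γ` with label `u` is
`e γ * u`, and these values satisfy no linear relations beyond the equalities `γ u = γ v`. This
determines the kernel. It is admissible: a path has length at most the weight of its start, and a
path of length at most one shares its class with no other path from the same vertex. Finally, a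
finite-dimensional quotient of a path algebra by an admissible ideal has the original quiver
(`isOrdinaryQuiver_of_isAdmissible`). -/

/-- The number of letters of a column in a given set of letters. -/
def Column.count {A : Type*} (γ : Column A) (p : A → Prop) [DecidablePred p] : ℕ := (γ.filter p).card

theorem Column.count_mono {A : Type*} (γ : Column A) {p q : A → Prop} [DecidablePred p] [DecidablePred q]
    (h : ∀ x, p x → q x) : γ.count p ≤ γ.count q :=
  Finset.card_le_card (Finset.monotone_filter_right γ fun x _ => h x)

/-! ### Column insertion, plactic relations and the weight -/

section ColumnInsertion

variable {A : Type*} [LinearOrder A]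

theorem leftInsert_cases (a : A) (γ : Column A) :
    (∃ d ∈ γ, a ≤ d ∧ (∀ y ∈ γ, a ≤ y → d ≤ y) ∧ leftInsert a γ = insert a (γ.erase d)) ∨
      ((∀ y ∈ γ, y < a) ∧ leftInsert a γ = insert a γ) := by
  unfold leftInsert
  split_ifs with h
  · left
    have hm := Finset.min'_mem _ h
    rw [Finset.mem_filter] at hm
    exact ⟨_, hm.1, hm.2,
      fun y hy hay => Finset.min'_le _ _ (Finset.mem_filter.2 ⟨hy, hay⟩), rfl⟩
  · right
    refine ⟨fun y hy => ?_, rfl⟩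
    by_contra hya
    exact h ⟨y, Finset.mem_filter.2 ⟨hy, not_lt.1 hya⟩⟩

theorem rightInsert_cases (γ : Column A) (c : A) :
    (∃ d ∈ γ, d ≤ c ∧ (∀ y ∈ γ, y ≤ c → y ≤ d) ∧ rightInsert γ c = insert c (γ.erase d)) ∨
      ((∀ y ∈ γ, c < y) ∧ rightInsert γ c = insert c γ) := by
  unfold rightInsert
  split_ifs with h
  · left
    have hm := Finset.max'_mem _ h
    rw [Finset.mem_filter] at hm
    exact ⟨_, hm.1, hm.2,
      fun y hy hay => Finset.le_max' _ _ (Finset.mem_filter.2 ⟨hy, hay⟩), rfl⟩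
  · right
    refine ⟨fun y hy => ?_, rfl⟩
    by_contra hya
    exact h ⟨y, Finset.mem_filter.2 ⟨hy, not_lt.1 hya⟩⟩

theorem mem_leftInsert_self (a : A) (γ : Column A) : a ∈ leftInsert a γ := by
  rcases leftInsert_cases a γ with ⟨d, -, -, -, h⟩ | ⟨-, h⟩ <;> rw [h] <;>
    exact Finset.mem_insert_self _ _

theorem mem_leftInsert_of_lt {a y : A} {γ : Column A} (hy : y ∈ γ) (hya : y < a) :
    y ∈ leftInsert a γ := by
  rcases leftInsert_cases a γ with ⟨d, -, had, -, h⟩ | ⟨-, h⟩ <;> rw [h]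
  · exact Finset.mem_insert_of_mem (Finset.mem_erase.2 ⟨(hya.trans_le had).ne, hy⟩)
  · exact Finset.mem_insert_of_mem hy

theorem leftInsert_subset (a : A) (γ : Column A) : leftInsert a γ ⊆ insert a γ := by
  rcases leftInsert_cases a γ with ⟨d, -, -, -, h⟩ | ⟨-, h⟩ <;> rw [h]
  exact Finset.insert_subset_insert _ (Finset.erase_subset _ _)

theorem leftInsert_of_mem {a : A} {γ : Column A} (ha : a ∈ γ) : leftInsert a γ = γ := by
  rcases leftInsert_cases a γ with ⟨d, -, had, hmin, h⟩ | ⟨-, h⟩ <;> rw [h]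
  · obtain rfl : a = d := le_antisymm had (hmin a ha le_rfl)
    exact Finset.insert_erase ha
  · exact Finset.insert_eq_of_mem ha

theorem leftInsert_eq_self_iff {a : A} {γ : Column A} : leftInsert a γ = γ ↔ a ∈ γ :=
  ⟨fun h => h ▸ mem_leftInsert_self a γ, leftInsert_of_mem⟩

theorem card_le_card_leftInsert (a : A) (γ : Column A) : γ.card ≤ (leftInsert a γ).card := by
  by_cases ha : a ∈ γ
  · rw [leftInsert_of_mem ha]
  rcases leftInsert_cases a γ with ⟨d, hd, -, -, h⟩ | ⟨-, h⟩ <;> rw [h]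
  · rw [Finset.card_insert_of_notMem (fun h => ha (Finset.mem_of_mem_erase h)),
      Finset.card_erase_add_one hd]
  · exact Finset.card_le_card (Finset.subset_insert _ _)

/-- The letters `≤ x` and the letters `< x` are two lower sets whose counts differ by one exactly
when `x` is in the column. -/
theorem Column.ext_count {γ δ : Column A}
    (h : ∀ (p : A → Prop) [DecidablePred p], (∀ x y, x ≤ y → p y → p x) →
      γ.count p = δ.count p) : γ = δ := by
  have key : ∀ (γ : Column A) (x : A),
      γ.count (· ≤ x) = γ.count (· < x) + if x ∈ γ then 1 else 0 := by
    intro γ x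
    unfold Column.count
    split_ifs with hx
    · rw [← Finset.card_insert_of_notMem (a := x) (by simp)]
      congr 1
      ext y
      simp only [Finset.mem_filter, Finset.mem_insert, le_iff_lt_or_eq]
      grind
    · congr 1
      ext y
      simp only [Finset.mem_filter, le_iff_lt_or_eq]
      grind
  ext x
  have h₁ := h (· ≤ x) (fun _ _ h h' => h.trans h')
  have h₂ := h (· < x) (fun _ _ h h' => h.trans_lt h')
  rw [key, key, h₂] at h₁
  by_cases hx : x ∈ γ <;> by_cases hx' : x ∈ δ <;> simp_all

/-- Column insertion in max-plus form. -/
theorem Column.count_leftInsert (a : A) (γ : Column A) (p : A → Prop) [DecidablePred p]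
    (hp : ∀ x y, x ≤ y → p y → p x) :
    (leftInsert a γ).count p =
      if p a then max (γ.count p) (γ.count (· < a) + 1) else γ.count p := by
  have hlt : p a → ∀ {d}, d ∈ γ → a ≤ d → p d → γ.count (· < a) + 1 ≤ γ.count p := by
    intro ha d hd had hpd
    unfold Column.count
    rw [← Finset.card_insert_of_notMem (a := d) (by simp [had])]
    refine Finset.card_le_card (Finset.insert_subset (by simp [hd, hpd]) ?_)
    exact Finset.monotone_filter_right γ fun x _ hx => hp x a (le_of_lt hx) ha
  have heq : p a → (∀ d ∈ γ, a ≤ d → ¬ p d) → γ.count p = γ.count (· < a) := by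
    intro ha hd
    unfold Column.count
    congr 1
    refine Finset.filter_congr fun x hx => ⟨fun hpx => ?_, fun h => hp x a h.le ha⟩
    by_contra h
    exact hd x hx (not_lt.1 h) hpx
  by_cases haγ : a ∈ γ
  · rw [leftInsert_of_mem haγ]
    split_ifs with hpa
    · exact (max_eq_left (hlt hpa haγ le_rfl hpa)).symm
    · rfl
  -- Only a lower set that contains `a` and misses the replaced letter `d` (if any) gains a letter.
  -- It meets `γ` in the letters below `a`, so the second term of the maximum wins; a lower set
  -- containing `d` already counts at least that much.
  rcases leftInsert_cases a γ with ⟨d, hd, had, hmin, h⟩ | ⟨hmax, h⟩ <;> rw [h]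
  · have h₁ : ((insert a (γ.erase d) : Column A).count p) =
        Column.count (γ.erase d) p + if p a then 1 else 0 := by
      unfold Column.count
      rw [Finset.filter_insert]
      split_ifs
      · rw [Finset.card_insert_of_notMem (by simp [haγ])]
      · rfl
    have h₂ : γ.count p = Column.count (γ.erase d) p + if p d then 1 else 0 := by
      unfold Column.count
      rw [Finset.filter_erase]
      split_ifs with hpd
      · rw [Finset.card_erase_add_one (by simp [hd, hpd])]
      · rw [Finset.erase_eq_of_notMem (by simp [hpd])]; rfl
    rw [h₁]
    by_cases hpd : p d
    · have hpa := hp a d had hpd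
      have := hlt hpa hd had hpd
      simp only [hpa, hpd, if_true] at h₂ ⊢
      omega
    · by_cases hpa : p a
      · have := heq hpa fun y hy hay hpy => hpd (hp d y (hmin y hy hay) hpy)
        simp only [hpa, hpd, if_true, if_false] at h₂ ⊢
        omega
      · simp only [hpa, hpd, if_false] at h₂ ⊢
        omega
  · have h₁ : ((insert a γ : Column A).count p) = γ.count p + if p a then 1 else 0 := by
      unfold Column.count
      rw [Finset.filter_insert]
      split_ifs
      · rw [Finset.card_insert_of_notMem (by simp [haγ])]
      · rfl
    rw [h₁]
    by_cases hpa : p a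
    · have := heq hpa fun y hy hay _ => absurd (hmax y hy) (not_lt.2 hay)
      simp only [hpa, if_true]
      omega
    · simp [hpa]

theorem lt_lowerClosed (a : A) : ∀ x y : A, x ≤ y → y < a → x < a := fun _ _ h h' => h.trans_lt h'

/-- The plactic relation `x z y = z x y` for `x ≤ y < z`. -/
theorem leftInsert_knuth_swap_left {x y z : A} (hxy : x ≤ y) (hyz : y < z) (γ : Column A) :
    leftInsert x (leftInsert z (leftInsert y γ)) = leftInsert z (leftInsert x (leftInsert y γ)) := by
  -- On counts both sides are max-plus expressions in the counts below `x`, `y`, `z`, which `m₁` and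
  -- `m₂` order.
  refine Column.ext_count fun p _ hp => ?_
  have hxz := hxy.trans_lt hyz
  have m₁ := γ.count_mono (p := (· < x)) (q := (· < y)) fun _ h => h.trans_le hxy
  have m₂ := γ.count_mono (p := (· < y)) (q := (· < z)) fun _ h => h.trans hyz
  simp only [Column.count_leftInsert _ _ _ hp, Column.count_leftInsert _ _ _ (lt_lowerClosed _),
    hxy.not_gt, hyz, hxz, hxz.not_gt, if_true, if_false]
  by_cases hx : p x <;> by_cases hz : p z <;> by_cases hy : p y <;>
    simp only [hx, hy, hz, if_true, if_false] <;> omega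

/-- The plactic relation `y x z = y z x` for `x < y ≤ z`. -/
theorem leftInsert_knuth_swap_right {x y z : A} (hxy : x < y) (hyz : y ≤ z) (γ : Column A) :
    leftInsert y (leftInsert x (leftInsert z γ)) = leftInsert y (leftInsert z (leftInsert x γ)) := by
  refine Column.ext_count fun p _ hp => ?_
  have hxz := hxy.trans_le hyz
  have m₁ := γ.count_mono (p := (· < x)) (q := (· < y)) fun _ h => h.trans hxy
  have m₂ := γ.count_mono (p := (· < y)) (q := (· < z)) fun _ h => h.trans_le hyz
  have h₂ := hp y z hyz
  simp only [Column.count_leftInsert _ _ _ hp, Column.count_leftInsert _ _ _ (lt_lowerClosed _),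
    hxy, hyz.not_gt, hxz, hxz.not_gt, if_true, if_false]
  by_cases hx : p x <;> by_cases hy : p y <;> by_cases hz : p z <;>
    simp only [hx, hy, hz, if_true, if_false] <;>
    first | omega | exact absurd (h₂ hz) hy

/-- A statistic of columns which column insertion never decreases. -/
def Column.weight [Fintype A] (γ : Column A) : ℕ :=
  ∑ y ∈ γ, (Finset.univ.filter (y ≤ ·)).card

theorem Column.weight_mono [Fintype A] {γ δ : Column A} (h : γ ⊆ δ) : γ.weight ≤ δ.weight :=
  Finset.sum_le_sum_of_subset h

theorem card_upper_pos [Fintype A] (a : A) : 0 < (Finset.univ.filter (a ≤ ·)).card :=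
  Finset.card_pos.2 ⟨a, by simp⟩

theorem card_upper_lt [Fintype A] {a b : A} (h : a < b) :
    (Finset.univ.filter (b ≤ ·)).card < (Finset.univ.filter (a ≤ ·)).card := by
  refine Finset.card_lt_card (Finset.ssubset_iff_of_subset ?_ |>.2 ⟨a, by simp, by simpa using h⟩)
  exact Finset.monotone_filter_right _ fun x _ hx => h.le.trans hx

theorem Column.weight_lt [Fintype A] {γ δ : Column A} (h : γ ⊂ δ) : γ.weight < δ.weight := by
  obtain ⟨x, hx, hx'⟩ := Finset.exists_of_ssubset h
  exact Finset.sum_lt_sum_of_subset h.1 hx hx' (card_upper_pos x) fun _ _ _ => Nat.zero_le _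

/-- A letter weighs the number of letters above or equal to it, so putting `a` in place of a larger
letter raises the weight, as does adding `a`. -/
theorem Column.weight_lt_leftInsert [Fintype A] {a : A} {γ : Column A} (ha : a ∉ γ) :
    γ.weight < (leftInsert a γ).weight := by
  rcases leftInsert_cases a γ with ⟨d, hd, had, -, h⟩ | ⟨-, h⟩ <;> rw [h]
  · have hlt : a < d := lt_of_le_of_ne had fun h => ha (h ▸ hd)
    unfold Column.weight
    rw [Finset.sum_insert (fun h => ha (Finset.mem_of_mem_erase h)),
      ← Finset.add_sum_erase γ _ hd]
    exact Nat.add_lt_add_right (card_upper_lt hlt) _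
  · exact Column.weight_lt (Finset.ssubset_insert ha)

end ColumnInsertion

/-! ### The stylic monoid acting on columns -/

namespace Styl

variable {A : Type*} [LinearOrder A]

/-- A letter, as an element of the stylic monoid. -/
def letter (a : A) : Styl A := toStyl (FreeMonoid.of a)

/-- A column, as an element of the stylic monoid. -/
def column (γ : Column A) : Styl A := toStyl (columnWord γ)

/-- The left action of the stylic monoid on columns. -/
def act (z : Styl A) (γ : Column A) : Column A := (z : Function.End (Column A)) γ

@[simp] theorem act_one (γ : Column A) : act 1 γ = γ := rfl

@[simp] theorem act_mul (z w : Styl A) (γ : Column A) : act (z * w) γ = act z (act w γ) := rfl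

@[simp] theorem act_letter (a : A) (γ : Column A) : act (letter a) γ = leftInsert a γ := rfl

theorem ext_act {z w : Styl A} (h : ∀ γ, act z γ = act w γ) : z = w := Subtype.ext (funext h)

@[elab_as_elim]
theorem letter_mul_induction {P : Styl A → Prop} (z : Styl A) (one : P 1)
    (mul : ∀ a z, P z → P (letter a * z)) : P z := by
  obtain ⟨_, w, rfl⟩ := z
  change P (toStyl w)
  induction w using FreeMonoid.inductionOn' with
  | one => rw [map_one]; exact one
  | of_mul a w ih => rw [map_mul]; exact mul a _ ih

theorem letter_knuth_swap_left {x y z : A} (hxy : x ≤ y) (hyz : y < z) :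
    letter x * letter z * letter y = letter z * letter x * letter y :=
  ext_act fun γ => by
    simp only [act_mul, act_letter]
    exact leftInsert_knuth_swap_left hxy hyz γ

theorem letter_knuth_swap_right {x y z : A} (hxy : x < y) (hyz : y ≤ z) :
    letter y * letter x * letter z = letter y * letter z * letter x :=
  ext_act fun γ => by
    simp only [act_mul, act_letter]
    exact leftInsert_knuth_swap_right hxy hyz γ

theorem letter_mul_self_of_forall {c : A} {z : Styl A} (h : ∀ γ, c ∈ act z γ) :
    letter c * z = z :=
  ext_act fun γ => leftInsert_of_mem (h γ)

section Monotone

theorem card_le_card_act (z : Styl A) (γ : Column A) : γ.card ≤ (act z γ).card := by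
  induction z using letter_mul_induction with
  | one => rfl
  | mul a z ih => exact ih.trans (card_le_card_leftInsert a _)

theorem weight_le_weight_act [Fintype A] (z : Styl A) (γ : Column A) :
    γ.weight ≤ (act z γ).weight := by
  induction z using letter_mul_induction with
  | one => rfl
  | mul a z ih =>
    refine ih.trans ?_
    rw [act_mul, act_letter]
    by_cases h : a ∈ act z γ
    · rw [leftInsert_of_mem h]
    · exact (Column.weight_lt_leftInsert h).le

/-- The weight never drops along the action, so a letter that moved `γ` could never be compensated
by later ones. -/
theorem act_mul_eq_self_iff [Fintype A] {z w : Styl A} {γ : Column A} :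
    act (z * w) γ = γ ↔ act z γ = γ ∧ act w γ = γ := by
  refine ⟨fun h => ?_, fun h => by rw [act_mul, h.2, h.1]⟩
  induction w using letter_mul_induction generalizing z with
  | one => exact ⟨by simpa using h, rfl⟩
  | mul a w ih =>
    rw [← mul_assoc] at h
    obtain ⟨h₁, h₂⟩ := ih h
    rw [act_mul, act_letter] at h₁
    by_cases ha : a ∈ γ
    · rw [leftInsert_of_mem ha] at h₁
      exact ⟨h₁, by rw [act_mul, h₂, act_letter, leftInsert_of_mem ha]⟩
    · have := weight_le_weight_act z (leftInsert a γ)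
      rw [h₁] at this
      exact absurd this (Column.weight_lt_leftInsert ha).not_ge

end Monotone

/-! ### Column words and the first column of an element -/

section Columns

theorem columnWord_union {γ δ : Column A} (h : ∀ x ∈ γ, ∀ y ∈ δ, y < x) :
    columnWord (γ ∪ δ) = columnWord γ * columnWord δ := by
  have hd : (γ.sort (· ≥ ·) ++ δ.sort (· ≥ ·)).Nodup := by
    rw [List.nodup_append]
    refine ⟨Finset.sort_nodup _ _, Finset.sort_nodup _ _, fun x hx y hy => ?_⟩
    rw [Finset.mem_sort] at hx hy
    exact (h x hx y hy).ne'
  have hs : (γ.sort (· ≥ ·) ++ δ.sort (· ≥ ·)).Pairwise (· ≥ ·) := by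
    rw [List.pairwise_append]
    refine ⟨Finset.pairwise_sort _ _, Finset.pairwise_sort _ _, fun x hx y hy => ?_⟩
    rw [Finset.mem_sort] at hx hy
    exact (h x hx y hy).le
  have := (List.toFinset_sort (· ≥ ·) hd).2 hs
  rw [List.toFinset_append, Finset.sort_toFinset, Finset.sort_toFinset] at this
  unfold columnWord
  rw [this, FreeMonoid.ofList_append]

theorem column_union {γ δ : Column A} (h : ∀ x ∈ γ, ∀ y ∈ δ, y < x) :
    column (γ ∪ δ) = column γ * column δ := by
  unfold column
  rw [columnWord_union h, map_mul]

@[simp] theorem column_empty : column (∅ : Column A) = 1 := by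
  simp [column, columnWord]

@[simp] theorem column_singleton (a : A) : column ({a} : Column A) = letter a := by
  simp [column, columnWord, letter]

theorem column_insert_of_lt {a : A} {γ : Column A} (h : ∀ y ∈ γ, y < a) :
    column (insert a γ) = letter a * column γ := by
  rw [Finset.insert_eq, column_union (by simpa using h), column_singleton]

theorem column_insert_of_gt {a : A} {γ : Column A} (h : ∀ y ∈ γ, a < y) :
    column (insert a γ) = column γ * letter a := by
  rw [Finset.insert_eq, Finset.union_comm, column_union (by simpa using h), column_singleton]

theorem column_insert_split (γ : Column A) (a : A) :
    column (insert a γ) =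
      column (γ.filter (a < ·)) * letter a * column (γ.filter (· < a)) := by
  have : insert a γ = (γ.filter (a < ·) ∪ {a}) ∪ γ.filter (· < a) := by
    ext x
    simp only [Finset.mem_insert, Finset.mem_union, Finset.mem_filter, Finset.mem_singleton]
    grind
  rw [this, column_union, column_union, column_singleton]
  · simp
  · simp only [Finset.mem_union, Finset.mem_filter, Finset.mem_singleton]
    rintro x (⟨-, hx⟩ | rfl) y ⟨-, hy⟩
    · exact hy.trans hx
    · exact hy

/-- The smallest letter of the word acts first, and each later one bumps only letters `≥` itself,
hence none of those already inserted. -/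
theorem subset_act_column (γ δ : Column A) : γ ⊆ act (column γ) δ := by
  induction γ using Finset.induction_on_max with
  | empty => simp
  | insert a s h ih =>
    rw [column_insert_of_lt h, act_mul, act_letter]
    exact Finset.insert_subset (mem_leftInsert_self _ _) fun y hy =>
      mem_leftInsert_of_lt (ih hy) (h y hy)

theorem act_column_subset (γ δ : Column A) : act (column γ) δ ⊆ γ ∪ δ := by
  induction γ using Finset.induction_on_max with
  | empty => simp
  | insert a s h ih =>
    rw [column_insert_of_lt h, act_mul, act_letter, Finset.insert_union]
    exact (leftInsert_subset _ _).trans (Finset.insert_subset_insert _ ih)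

@[simp] theorem act_column_empty (γ : Column A) : act (column γ) ∅ = γ :=
  Finset.Subset.antisymm (by simpa using act_column_subset γ ∅) (subset_act_column γ ∅)

theorem act_column_eq_self_iff {γ δ : Column A} : act (column γ) δ = δ ↔ γ ⊆ δ := by
  refine ⟨fun h => h ▸ subset_act_column γ δ, fun h => ?_⟩
  refine (Finset.eq_of_subset_of_card_le ?_ (card_le_card_act _ _))
  exact (act_column_subset γ δ).trans (Finset.union_subset h subset_rfl)

theorem letter_mul_column_of_mem {c : A} {γ : Column A} (h : c ∈ γ) :
    letter c * column γ = column γ :=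
  letter_mul_self_of_forall fun δ => subset_act_column γ δ h

theorem column_mul_self (γ : Column A) : column γ * column γ = column γ :=
  ext_act fun δ => by
    rw [act_mul, act_column_eq_self_iff]
    exact subset_act_column γ δ

/-- The letter `c` moves left past each `x` of `γ` by `y x z = y z x`, with `z = c` and `y` the
letter just before `x`. -/
theorem letter_mul_column_mul_letter {d c : A} (hdc : d ≤ c) (γ : Column A)
    (h : ∀ y ∈ γ, y < d) :
    letter d * column γ * letter c = letter d * letter c * column γ := by
  induction γ using Finset.induction_on_max generalizing d with
  | empty => simp
  | insert a s has ih =>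
    have had := h a (Finset.mem_insert_self a s)
    rw [column_insert_of_lt has]
    calc letter d * (letter a * column s) * letter c
        = letter d * (letter a * column s * letter c) := by simp only [mul_assoc]
      _ = letter d * letter a * letter c * column s := by
          rw [ih (had.le.trans hdc) has]; simp only [mul_assoc]
      _ = _ := by rw [letter_knuth_swap_right had hdc]; simp only [mul_assoc]

/-- The letter `d` moves left past each `z` of `γ` by `z x y = x z y`, with `x = d` and `y` the
letter just after `d`: first `c`, then the letter of `γ` last passed. -/
theorem column_mul_letter_mul_letter {d c : A} (hdc : d ≤ c) (γ : Column A)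
    (h : ∀ y ∈ γ, c < y) :
    column γ * letter d * letter c = letter d * column γ * letter c := by
  induction γ using Finset.induction_on_max with
  | empty => simp
  | insert a s has ih =>
    have hca := h a (Finset.mem_insert_self a s)
    rw [column_insert_of_lt has]
    have ih' := ih fun y hy => h y (Finset.mem_insert_of_mem hy)
    rcases s.eq_empty_or_nonempty with rfl | hs
    · simp only [column_empty, mul_one]
      exact (letter_knuth_swap_left hdc hca).symm
    have hm := Finset.max'_mem s hs
    set m := s.max' hs with hm'
    have hs' : column s = letter m * column (s.erase m) := by
      rw [← column_insert_of_lt, Finset.insert_erase hm]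
      intro y hy
      exact Finset.lt_max'_of_mem_erase_max' s hs hy
    calc letter a * column s * letter d * letter c
        = letter a * (column s * letter d * letter c) := by simp only [mul_assoc]
      _ = letter a * letter d * letter m * column (s.erase m) * letter c := by
          rw [ih', hs']; simp only [mul_assoc]
      _ = letter d * (letter a * column s) * letter c := by
          rw [← letter_knuth_swap_left (hdc.trans (h m (Finset.mem_insert_of_mem hm)).le)
            (has m hm), hs']
          simp only [mul_assoc]

/-- The frank commutation of a column and a letter. -/
theorem column_mul_letter_of_pred {γ : Column A} {d c : A} (hd : d ∈ γ) (hdc : d ≤ c)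
    (hmax : ∀ y ∈ γ, y ≤ c → y ≤ d) :
    column γ * letter c = letter d * column (insert c (γ.erase d)) := by
  -- No letter of `γ` lies in `(d, c]`, so cutting `γ.erase d` at `d` or at `c` gives the same two
  -- pieces. Then `c` crosses the lower piece and `d` the upper one.
  have h₁ : γ.filter (d < ·) = (γ.erase d).filter (c < ·) := by
    ext x
    simp only [Finset.mem_filter, Finset.mem_erase]
    refine ⟨fun ⟨hx, hdx⟩ => ⟨⟨hdx.ne', hx⟩, ?_⟩, fun ⟨⟨_, hx⟩, hcx⟩ => ⟨hx, hdc.trans_lt hcx⟩⟩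
    by_contra h
    exact hdx.not_ge (hmax x hx (not_lt.1 h))
  have h₂ : γ.filter (· < d) = (γ.erase d).filter (· < c) := by
    ext x
    simp only [Finset.mem_filter, Finset.mem_erase]
    refine ⟨fun ⟨hx, hdx⟩ => ⟨⟨hdx.ne, hx⟩, hdx.trans_le hdc⟩, fun ⟨⟨hne, hx⟩, hcx⟩ => ⟨hx, ?_⟩⟩
    exact lt_of_le_of_ne (hmax x hx hcx.le) hne
  conv_lhs => rw [← Finset.insert_eq_of_mem hd]
  rw [column_insert_split, column_insert_split, ← h₁, ← h₂]
  calc column (γ.filter (d < ·)) * letter d * column (γ.filter (· < d)) * letter c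
      = column (γ.filter (d < ·)) * (letter d * column (γ.filter (· < d)) * letter c) := by
        simp only [mul_assoc]
    _ = column (γ.filter (d < ·)) * letter d * letter c * column (γ.filter (· < d)) := by
        rw [letter_mul_column_mul_letter hdc _ (by simp)]; simp only [mul_assoc]
    _ = _ := by
        rw [column_mul_letter_mul_letter hdc]
        · simp only [mul_assoc]
        · rw [h₁]; simp

theorem column_mul_letter_of_mem {γ : Column A} {c : A} (hc : c ∈ γ) :
    column γ * letter c = column γ := by
  rw [column_mul_letter_of_pred hc le_rfl fun y _ h => h, Finset.insert_erase hc,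
    letter_mul_column_of_mem hc]

theorem column_mul_letter (γ : Column A) (c : A) :
    ∃ u : Styl A, column γ * letter c = u * column (rightInsert γ c) := by
  rcases rightInsert_cases γ c with ⟨d, hd, hdc, hmax, h⟩ | ⟨hlt, h⟩ <;> rw [h]
  · exact ⟨_, column_mul_letter_of_pred hd hdc hmax⟩
  · exact ⟨1, by rw [one_mul, column_insert_of_gt hlt]⟩

/-- The bumped letter `d` comes out on the right: this is the frank commutation of the column `a ·
γ` with `d`, read backwards. -/
theorem letter_mul_column (a : A) (γ : Column A) :
    ∃ u : Styl A, letter a * column γ = column (leftInsert a γ) * u := by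
  by_cases ha : a ∈ γ
  · exact ⟨1, by rw [leftInsert_of_mem ha, mul_one, letter_mul_column_of_mem ha]⟩
  rcases leftInsert_cases a γ with ⟨d, hd, had, hmin, h⟩ | ⟨hlt, h⟩ <;> rw [h]
  · refine ⟨letter d, ?_⟩
    rw [column_mul_letter_of_pred (d := a) (Finset.mem_insert_self _ _) had,
      Finset.erase_insert (fun h => ha (Finset.mem_of_mem_erase h)), Finset.insert_erase hd]
    intro y hy hyd
    rw [Finset.mem_insert, Finset.mem_erase] at hy
    rcases hy with rfl | ⟨hne, hy⟩
    · exact le_rfl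
    · by_contra h
      exact hne (le_antisymm hyd (hmin y hy (not_le.1 h).le))
  · exact ⟨1, by rw [mul_one, column_insert_of_lt hlt]⟩

/-- The column `act z ∅` behaves like the first column of an insertion tableau; each new letter on
the left updates it and pushes a factor to its right. -/
theorem exists_eq_column_mul (z : Styl A) : ∃ u : Styl A, z = column (act z ∅) * u := by
  induction z using letter_mul_induction with
  | one => exact ⟨1, by simp⟩
  | mul a z ih =>
    obtain ⟨u, hu⟩ := ih
    obtain ⟨v, hv⟩ := letter_mul_column a (act z ∅)
    refine ⟨v * u, ?_⟩
    rw [act_mul, act_letter, ← mul_assoc, ← hv, mul_assoc, ← hu]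

theorem column_act_empty_mul (z : Styl A) : column (act z ∅) * z = z := by
  obtain ⟨u, hu⟩ := exists_eq_column_mul z
  have h : column (act z ∅) * (column (act z ∅) * u) = column (act z ∅) * u := by
    rw [← mul_assoc, column_mul_self]
  rwa [← hu] at h

theorem letter_mul_of_mem_act_empty {c : A} {z : Styl A} (h : c ∈ act z ∅) :
    letter c * z = z := by
  conv_lhs => rw [← column_act_empty_mul z]
  rw [← mul_assoc, letter_mul_column_of_mem h, column_act_empty_mul]

end Columns

/-! ### Frank right actions -/

section Frank

/-- A frank right action exchanges a letter with a column. -/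
theorem exists_of_isFrank {γ : Column A} {c : A} (h : IsFrank γ c) :
    ∃ d ∈ γ, d < c ∧ column γ * letter c = letter d * column (rightInsert γ c) ∧
      leftInsert d (rightInsert γ c) = γ ∧ d ∉ rightInsert γ c ∧
      (rightInsert γ c).card = γ.card := by
  obtain ⟨⟨x, hx, hxc⟩, hc⟩ := h
  rcases rightInsert_cases γ c with ⟨d, hd, hdc, hmax, h⟩ | ⟨hlt, -⟩
  · have hdc' : d < c := lt_of_le_of_ne hdc fun h => hc (h ▸ hd)
    have hdn : d ∉ rightInsert γ c := by
      rw [h]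
      simp [hdc'.ne]
    have hcol : column γ * letter c = letter d * column (rightInsert γ c) := by
      rw [h, column_mul_letter_of_pred hd hdc hmax]
    have hcard : (rightInsert γ c).card = γ.card := by
      rw [h, Finset.card_insert_of_notMem (fun h => hc (Finset.mem_of_mem_erase h)),
        Finset.card_erase_add_one hd]
    refine ⟨d, hd, hdc', hcol, ?_, hdn, hcard⟩
    have hmin : ∀ y ∈ insert c (γ.erase d), d ≤ y → c ≤ y := by
      intro y hy hdy
      rw [Finset.mem_insert, Finset.mem_erase] at hy
      rcases hy with rfl | ⟨hne, hy⟩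
      · exact le_rfl
      · by_contra hcy
        exact hne (le_antisymm (hmax y hy (not_le.1 hcy).le) hdy)
    rcases leftInsert_cases d (rightInsert γ c) with ⟨e, he, hde, hmin', h'⟩ | ⟨hlt, -⟩
    · obtain rfl : e = c := by
        rw [h] at he hmin'
        exact le_antisymm (hmin' c (Finset.mem_insert_self _ _) hdc) (hmin e he hde)
      rw [h', h, Finset.erase_insert (fun h => hc (Finset.mem_of_mem_erase h)),
        Finset.insert_erase hd]
    · exact absurd (hlt c (h ▸ Finset.mem_insert_self _ _)) hdc'.not_gt
  · exact absurd (hlt x hx) hxc.not_gt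

/-- Inserting the exchanged letter `d` recovers `γ` and raises the weight. This bounds the length of
paths in `Q(A)`. -/
theorem weight_rightInsert_lt [Fintype A] {γ : Column A} {c : A} (h : IsFrank γ c) :
    (rightInsert γ c).weight < γ.weight := by
  obtain ⟨d, -, -, -, h₁, h₂, -⟩ := exists_of_isFrank h
  have := Column.weight_lt_leftInsert h₂
  rwa [h₁] at this

end Frank

end Styl

/-! ### Products of the factors `1 - a` in the stylic algebra -/

namespace StylAlgebra

open Styl

variable {K : Type*} [Field K] {A : Type*} [LinearOrder A]

variable (K) in
/-- The basis of the stylic algebra formed by the elements of the stylic monoid. -/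
noncomputable abbrev ofStyl : Styl A →* StylAlgebra K A := MonoidAlgebra.of K (Styl A)

theorem stylLetter_eq (a : A) : stylLetter K a = ofStyl K (letter a) := rfl

theorem span_ofStyl : Submodule.span K (Set.range (ofStyl K (A := A))) = ⊤ :=
  (MonoidAlgebra.basis (Styl A) K).span_eq

theorem linearIndependent_ofStyl : LinearIndependent K (ofStyl K (A := A)) :=
  (MonoidAlgebra.basis (Styl A) K).linearIndependent

theorem toStyl_ofList (l : List A) : toStyl (FreeMonoid.ofList l) = (l.map letter).prod := by
  induction l with
  | nil => simp
  | cons a l ih => rw [FreeMonoid.ofList_cons, map_mul, ih, List.map_cons, List.prod_cons, letter]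

theorem prod_map_stylLetter (γ : Column A) :
    ((γ.sort (· ≥ ·)).map fun a => stylLetter K a).prod = ofStyl K (column γ) := by
  rw [column, columnWord, toStyl_ofList, map_list_prod, List.map_map]
  rfl

variable (K) in
/-- The product of the factors `1 - a`, for the letters `a` of a list. -/
noncomputable def coProd (l : List A) : StylAlgebra K A :=
  (l.map fun a => 1 - stylLetter K a).prod

@[simp] theorem coProd_nil : coProd K ([] : List A) = 1 := rfl

@[simp] theorem coProd_cons (a : A) (l : List A) :
    coProd K (a :: l) = (1 - stylLetter K a) * coProd K l := by simp [coProd]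

@[simp] theorem coProd_append (l₁ l₂ : List A) :
    coProd K (l₁ ++ l₂) = coProd K l₁ * coProd K l₂ := by simp [coProd]

theorem exists_sort_eq_append (s : Finset A) {c : A} (hc : c ∈ s) :
    ∃ l₁ l₂ : List A, s.sort (· ≤ ·) = l₁ ++ c :: l₂ ∧ (∀ x ∈ l₁, x < c) ∧ ∀ x ∈ l₂, c < x := by
  obtain ⟨l₁, l₂, h⟩ := List.append_of_mem ((Finset.mem_sort (· ≤ ·)).2 hc)
  have hs := s.sortedLT_sort.pairwise
  have h' : s.sort = l₁ ++ c :: l₂ := h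
  rw [h', List.pairwise_append, List.pairwise_cons] at hs
  exact ⟨l₁, l₂, h, fun x hx => hs.2.2 x hx c (by simp), hs.2.1.1⟩

theorem span_mul_left_mem {s t : Set (Styl A)} {y : Styl A}
    (h : ∀ z ∈ s, y * z ∈ t) {x : StylAlgebra K A}
    (hx : x ∈ Submodule.span K (ofStyl K '' s)) :
    ofStyl K y * x ∈ Submodule.span K (ofStyl K '' t) := by
  refine Submodule.span_induction (p := fun x _ => ofStyl K y * x ∈ Submodule.span K (ofStyl K '' t))
    ?_ (by simp) (fun x y _ _ hx hy => ?_) (fun a x _ hx => ?_) hx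
  · rintro _ ⟨z, hz, rfl⟩
    rw [← map_mul]
    exact Submodule.subset_span ⟨_, h z hz, rfl⟩
  · rw [mul_add]; exact add_mem hx hy
  · rw [mul_smul_comm]; exact Submodule.smul_mem _ _ hx

theorem span_mul_right_mem {s t : Set (Styl A)} {y : Styl A}
    (h : ∀ z ∈ s, z * y ∈ t) {x : StylAlgebra K A}
    (hx : x ∈ Submodule.span K (ofStyl K '' s)) :
    x * ofStyl K y ∈ Submodule.span K (ofStyl K '' t) := by
  refine Submodule.span_induction (p := fun x _ => x * ofStyl K y ∈ Submodule.span K (ofStyl K '' t))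
    ?_ (by simp) (fun x y _ _ hx hy => ?_) (fun a x _ hx => ?_) hx
  · rintro _ ⟨z, hz, rfl⟩
    rw [← map_mul]
    exact Submodule.subset_span ⟨_, h z hz, rfl⟩
  · rw [add_mul]; exact add_mem hx hy
  · rw [smul_mul_assoc]; exact Submodule.smul_mem _ _ hx

theorem linearMap_eq_zero_of_mem_span {M : Type*} [AddCommGroup M] [Module K M]
    (f : StylAlgebra K A →ₗ[K] M) {s : Set (Styl A)} (h : ∀ z ∈ s, f (ofStyl K z) = 0)
    {x : StylAlgebra K A} (hx : x ∈ Submodule.span K (ofStyl K '' s)) : f x = 0 := by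
  have : Submodule.span K (ofStyl K '' s) ≤ LinearMap.ker f :=
    Submodule.span_le.2 (by rintro _ ⟨z, hz, rfl⟩; exact h z hz)
  exact this hx

/-- The product `∏↗ (1 - a)` kills the elements whose first column contains one of the letters. -/
theorem coProd_sort_mul_eq_zero {s : Finset A} {c : A} (hc : c ∈ s) {z : Styl A}
    (hz : c ∈ act z ∅) : coProd K (s.sort (· ≤ ·)) * ofStyl K z = 0 := by
  obtain ⟨l₁, l₂, h, -, hl₂⟩ := exists_sort_eq_append s hc
  rw [h, coProd_append, coProd_cons, mul_assoc, mul_assoc]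
  -- The factors to the right of `1 - c` involve letters larger than `c`, whose insertion keeps `c`
  -- in the first column; then `1 - c` annihilates.
  have h₁ : coProd K l₂ * ofStyl K z ∈ Submodule.span K (ofStyl K '' {z | c ∈ act z ∅}) := by
    clear h
    induction l₂ with
    | nil =>
      rw [coProd_nil, one_mul]
      exact Submodule.subset_span ⟨z, hz, rfl⟩
    | cons a l ih =>
      have ih' := ih fun x hx => hl₂ x (List.mem_cons_of_mem _ hx)
      rw [coProd_cons, mul_assoc, sub_mul, one_mul, stylLetter_eq]
      refine sub_mem ih' (span_mul_left_mem (y := letter a) (fun z hz => ?_) ih')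
      exact mem_leftInsert_of_lt hz (hl₂ a List.mem_cons_self)
  have h₂ := linearMap_eq_zero_of_mem_span (LinearMap.mulLeft K (1 - stylLetter K c))
    (s := {z | c ∈ act z ∅}) (fun z hz => ?_) h₁
  · rw [LinearMap.mulLeft_apply] at h₂
    rw [h₂, mul_zero]
  · rw [LinearMap.mulLeft_apply, stylLetter_eq, sub_mul, one_mul, ← map_mul,
      letter_mul_of_mem_act_empty hz, sub_self]

/-- The factors before `1 - c` involve letters `a < c`. Acting on the right, such an `a` replaces
only letters `≤ a`, so `c` stays in the rightmost column, which absorbs it and is killed by `1 - c`.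
-/
theorem mul_coProd_sort_eq_zero {s : Finset A} {c : A} (hc : c ∈ s) {γ : Column A}
    (hγ : c ∈ γ) (x : StylAlgebra K A) :
    x * ofStyl K (column γ) * coProd K (s.sort (· ≤ ·)) = 0 := by
  obtain ⟨l₁, l₂, h, hl₁, -⟩ := exists_sort_eq_append s hc
  rw [h, coProd_append, coProd_cons, ← mul_assoc, ← mul_assoc]
  let t : Set (Styl A) := {z | ∃ u γ, c ∈ γ ∧ z = u * column γ}
  have h₀ : x * ofStyl K (column γ) ∈ Submodule.span K (ofStyl K '' t) := by
    have hx : x ∈ Submodule.span K (ofStyl K '' Set.univ) := by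
      rw [Set.image_univ, span_ofStyl]; trivial
    refine span_mul_right_mem (t := t) (y := column γ) (fun z _ => ?_) hx
    exact ⟨z, γ, hγ, rfl⟩
  have h₁ : ∀ y ∈ Submodule.span K (ofStyl K '' t),
      y * coProd K l₁ ∈ Submodule.span K (ofStyl K '' t) := by
    clear h
    induction l₁ with
    | nil =>
      intro y hy
      rwa [coProd_nil, mul_one]
    | cons a l ih =>
      intro y hy
      rw [coProd_cons, ← mul_assoc, mul_sub, mul_one, stylLetter_eq]
      refine ih (fun x hx => hl₁ x (List.mem_cons_of_mem _ hx)) _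
        (sub_mem hy (span_mul_right_mem (y := letter a) ?_ hy))
      rintro _ ⟨u, γ, hγ, rfl⟩
      obtain ⟨v, hv⟩ := column_mul_letter γ a
      refine ⟨u * v, rightInsert γ a, ?_, by rw [mul_assoc, hv, mul_assoc]⟩
      have hac := hl₁ a List.mem_cons_self
      rcases rightInsert_cases γ a with ⟨d, hd, hda, -, h⟩ | ⟨-, h⟩ <;> rw [h]
      · exact Finset.mem_insert_of_mem (Finset.mem_erase.2 ⟨(hda.trans_lt hac).ne', hγ⟩)
      · exact Finset.mem_insert_of_mem hγ
  have h₂ := linearMap_eq_zero_of_mem_span (LinearMap.mulRight K (1 - stylLetter K c))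
    (s := t) (fun z hz => ?_) (h₁ _ h₀)
  · rw [LinearMap.mulRight_apply] at h₂
    rw [h₂, zero_mul]
  · obtain ⟨u, γ, hγ, rfl⟩ := hz
    rw [LinearMap.mulRight_apply, stylLetter_eq, mul_sub, mul_one, ← map_mul, mul_assoc,
      column_mul_letter_of_mem hγ, sub_self]

section FirstColumn

variable (K) in
open Classical in
/-- The projection onto the span of the elements with first column `γ`. -/
noncomputable def firstColumnPart (γ : Column A) : StylAlgebra K A →ₗ[K] StylAlgebra K A :=
  (MonoidAlgebra.basis (Styl A) K).constr K fun z => if act z ∅ = γ then ofStyl K z else 0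

theorem firstColumnPart_of_eq {γ : Column A} {z : Styl A} (h : act z ∅ = γ) :
    firstColumnPart K γ (ofStyl K z) = ofStyl K z := by
  exact ((MonoidAlgebra.basis (Styl A) K).constr_basis K _ z).trans (if_pos h)

theorem firstColumnPart_of_ne {γ : Column A} {z : Styl A} (h : act z ∅ ≠ γ) :
    firstColumnPart K γ (ofStyl K z) = 0 := by
  exact ((MonoidAlgebra.basis (Styl A) K).constr_basis K _ z).trans (if_neg h)

theorem firstColumnPart_stylLetter_mul {γ : Column A} {a : A} (ha : a ∉ γ)
    (x : StylAlgebra K A) : firstColumnPart K γ (stylLetter K a * x) = 0 := by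
  have hx : x ∈ Submodule.span K (ofStyl K '' Set.univ) := by
    rw [Set.image_univ, span_ofStyl]; trivial
  refine linearMap_eq_zero_of_mem_span (firstColumnPart K γ ∘ₗ LinearMap.mulLeft K (stylLetter K a))
    (fun z _ => ?_) hx
  rw [LinearMap.comp_apply, LinearMap.mulLeft_apply, stylLetter_eq, ← map_mul]
  refine firstColumnPart_of_ne fun h => ha ?_
  rw [← h, act_mul]
  exact mem_leftInsert_self _ _

/-- Every term of the expanded product except `1` begins with a letter outside `γ`, and that letter
shows up in the first column. -/
theorem firstColumnPart_coProd_mul {γ : Column A} {l : List A} (hl : ∀ a ∈ l, a ∉ γ)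
    (x : StylAlgebra K A) : firstColumnPart K γ (coProd K l * x) = firstColumnPart K γ x := by
  induction l with
  | nil => simp
  | cons a l ih =>
    rw [coProd_cons, mul_assoc, sub_mul, one_mul, map_sub,
      firstColumnPart_stylLetter_mul (hl a List.mem_cons_self), sub_zero,
      ih fun x hx => hl x (List.mem_cons_of_mem _ hx)]

end FirstColumn

/-- For a new largest letter `m`, the subsets `γ` and `γ ∪ {m}` contribute the factors `1 - m` and
`m` in the same place, so together they restore the term of `γ`. -/
theorem sum_powerset_coProd_mul (s : Finset A) :
    ∑ γ ∈ s.powerset, coProd K ((s \ γ).sort (· ≤ ·)) * ofStyl K (column γ) = 1 := by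
  induction s using Finset.induction_on_max with
  | empty => simp [MonoidAlgebra.one_def]
  | insert m s hm ih =>
    have hms : m ∉ s := fun h => (hm m h).false
    rw [Finset.sum_powerset_insert hms, ← Finset.sum_add_distrib, ← ih]
    refine Finset.sum_congr rfl fun γ hγ => ?_
    rw [Finset.mem_powerset] at hγ
    have hmγ : m ∉ γ := fun h => hms (hγ h)
    have h₁ : (insert m s \ γ).sort (· ≤ ·) = (s \ γ).sort (· ≤ ·) ++ [m] := by
      have hd : ((s \ γ).sort (· ≤ ·) ++ [m]).Nodup := by
        rw [List.nodup_append]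
        refine ⟨Finset.sort_nodup _ _, by simp, fun x hx y hy => ?_⟩
        rw [Finset.mem_sort, Finset.mem_sdiff] at hx
        rw [List.mem_singleton.1 hy]
        exact (hm x hx.1).ne
      have hs : ((s \ γ).sort (· ≤ ·) ++ [m]).Pairwise (· ≤ ·) := by
        rw [List.pairwise_append]
        refine ⟨Finset.pairwise_sort _ _, by simp, fun x hx y hy => ?_⟩
        rw [Finset.mem_sort, Finset.mem_sdiff] at hx
        rw [List.mem_singleton.1 hy]
        exact (hm x hx.1).le
      rw [← (List.toFinset_sort (· ≤ ·) hd).2 hs, List.toFinset_append, Finset.sort_toFinset]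
      congr 1
      ext x
      simp only [Finset.mem_sdiff, Finset.mem_insert, Finset.mem_union, List.mem_toFinset,
        List.mem_singleton]
      grind
    have h₂ : insert m s \ insert m γ = s \ γ := by
      ext x
      simp only [Finset.mem_sdiff, Finset.mem_insert]
      grind
    rw [h₁, h₂, column_insert_of_lt fun y hy => hm y (hγ hy), coProd_append, coProd_cons,
      coProd_nil, stylLetter_eq, map_mul]
    noncomm_ring

/-! ### The idempotents of columns -/

section Idempotents

variable [Fintype A]

theorem columnIdem_eq (γ : Column A) :
    columnIdem K γ = coProd K ((γᶜ).sort (· ≤ ·)) * ofStyl K (column γ) := by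
  rw [columnIdem, prod_map_stylLetter]; rfl

theorem columnIdem_mul_ofStyl (γ : Column A) (z : Styl A) :
    columnIdem K γ * ofStyl K z =
      coProd K ((γᶜ).sort (· ≤ ·)) * ofStyl K (column γ * z) := by
  rw [columnIdem_eq, mul_assoc, ← map_mul]

theorem columnIdem_mul_eq_zero {γ : Column A} {z : Styl A} (h : act (column γ * z) ∅ ≠ γ) :
    columnIdem K γ * ofStyl K z = 0 := by
  rw [columnIdem_mul_ofStyl]
  have hs : γ ⊂ act (column γ * z) ∅ := (subset_act_column γ _).ssubset_of_ne h.symm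
  obtain ⟨c, hc, hc'⟩ := Finset.exists_of_ssubset hs
  exact coProd_sort_mul_eq_zero (Finset.mem_compl.2 hc') hc

/-- In the nonvanishing case `γ z` can be read off from `e γ * z`; this is the source of all linear
independence below. -/
theorem firstColumnPart_columnIdem_mul {γ : Column A} {z : Styl A}
    (h : act (column γ * z) ∅ = γ) :
    firstColumnPart K γ (columnIdem K γ * ofStyl K z) = ofStyl K (column γ * z) := by
  rw [columnIdem_mul_ofStyl, firstColumnPart_coProd_mul (fun a ha => by simpa using ha),
    firstColumnPart_of_eq h]

theorem columnIdem_mul_letter_of_mem {γ : Column A} {c : A} (hc : c ∈ γ) :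
    columnIdem K γ * stylLetter K c = columnIdem K γ := by
  rw [stylLetter_eq, columnIdem_mul_ofStyl, column_mul_letter_of_mem hc, columnIdem_eq]

theorem columnIdem_mul_letter_of_not_isFrank {γ : Column A} {c : A} (hc : c ∉ γ)
    (h : ¬ IsFrank γ c) : columnIdem K γ * stylLetter K c = 0 := by
  have hlt : ∀ y ∈ γ, c < y := fun y hy => by
    by_contra hyc
    exact h ⟨⟨y, hy, not_lt.1 hyc⟩, hc⟩
  rw [stylLetter_eq]
  refine columnIdem_mul_eq_zero fun h' => hc ?_
  rw [← column_insert_of_gt hlt, act_column_empty] at h'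
  rw [← h']
  exact Finset.mem_insert_self _ _

/-- The elements whose first column has weight larger than `n`. -/
def heavy (A : Type*) [LinearOrder A] [Fintype A] (n : ℕ) : Set (Styl A) :=
  {z | n < (act z ∅).weight}

/-- The first letter to act on `γ` in any other term of the expansion is outside `γ`, so it raises
the weight, and further letters cannot lower it. -/
theorem columnIdem_sub_mem (γ : Column A) :
    columnIdem K γ - ofStyl K (column γ) ∈
      Submodule.span K (ofStyl K '' heavy A γ.weight) := by
  rw [columnIdem_eq]
  have hl : ∀ a ∈ (γᶜ).sort (· ≤ ·), a ∉ γ := fun a ha => by simpa using ha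
  generalize (γᶜ).sort (· ≤ ·) = l at hl
  induction l with
  | nil => simp
  | cons a l ih =>
    have ih' := ih fun x hx => hl x (List.mem_cons_of_mem _ hx)
    have h₁ : ofStyl K (letter a) * (coProd K l * ofStyl K (column γ) - ofStyl K (column γ)) ∈
        Submodule.span K (ofStyl K '' heavy A γ.weight) := by
      refine span_mul_left_mem (fun z hz => ?_) ih'
      exact lt_of_lt_of_le hz (weight_le_weight_act (letter a) (act z ∅))
    have h₂ : ofStyl K (letter a * column γ) ∈
        Submodule.span K (ofStyl K '' heavy A γ.weight) := by
      refine Submodule.subset_span ⟨_, ?_, rfl⟩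
      change γ.weight < (act (letter a * column γ) ∅).weight
      rw [act_mul, act_column_empty]
      exact Column.weight_lt_leftInsert (hl a List.mem_cons_self)
    have h₃ : coProd K (a :: l) * ofStyl K (column γ) - ofStyl K (column γ) =
        (coProd K l * ofStyl K (column γ) - ofStyl K (column γ)) -
          (ofStyl K (letter a) * (coProd K l * ofStyl K (column γ) - ofStyl K (column γ)) +
            ofStyl K (letter a * column γ)) := by
      rw [coProd_cons, stylLetter_eq, map_mul]
      noncomm_ring
    rw [h₃]
    exact sub_mem ih' (add_mem h₁ h₂)

/-- Right multiplication by `e δ` only depends on the leading term, as soon as `x` kills the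
elements of larger weight. -/
theorem mul_columnIdem {x : StylAlgebra K A} {δ : Column A}
    (h : ∀ z : Styl A, δ.weight < (act z ∅).weight → x * ofStyl K z = 0) :
    x * columnIdem K δ = x * ofStyl K (column δ) := by
  rw [← sub_eq_zero, ← mul_sub]
  exact linearMap_eq_zero_of_mem_span (LinearMap.mulLeft K x) h (columnIdem_sub_mem δ)

theorem columnIdem_mul_eq_zero_of_weight_lt {γ : Column A} {z : Styl A}
    (h : γ.weight < (act z ∅).weight) : columnIdem K γ * ofStyl K z = 0 := by
  refine columnIdem_mul_eq_zero fun h' => h.not_ge ?_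
  rw [act_mul] at h'
  exact (weight_le_weight_act (column γ) _).trans (congrArg Column.weight h').le

theorem columnIdem_mul_self (γ : Column A) :
    columnIdem K γ * columnIdem K γ = columnIdem K γ := by
  rw [mul_columnIdem fun z hz => columnIdem_mul_eq_zero_of_weight_lt hz, columnIdem_mul_ofStyl,
    column_mul_self, columnIdem_eq]

/-- If `γ ⊂ δ`, all terms of `e δ` are heavier than `γ` and die under `e γ`. Otherwise a letter of
`γ` outside `δ` meets its factor `1 - c` in `e δ`. -/
theorem columnIdem_mul_of_ne {γ δ : Column A} (h : γ ≠ δ) :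
    columnIdem K γ * columnIdem K δ = 0 := by
  by_cases hs : γ ⊆ δ
  · have hw := Column.weight_lt (hs.ssubset_of_ne h)
    rw [mul_columnIdem fun z hz => columnIdem_mul_eq_zero_of_weight_lt (hw.trans hz),
      columnIdem_mul_eq_zero_of_weight_lt (by rwa [act_column_empty])]
  · obtain ⟨c, hc, hc'⟩ := Finset.not_subset.1 hs
    rw [columnIdem_eq δ, columnIdem_eq γ, ← mul_assoc,
      mul_coProd_sort_eq_zero (Finset.mem_compl.2 hc') hc, zero_mul]

theorem columnIdem_mul_letter_mul {γ : Column A} {c : A} (h : IsFrank γ c) :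
    columnIdem K γ * stylLetter K c * columnIdem K (rightInsert γ c) =
      columnIdem K γ * stylLetter K c := by
  obtain ⟨d, -, -, h₁, h₂, -, hcard⟩ := exists_of_isFrank h
  rw [mul_columnIdem]
  · rw [mul_assoc, stylLetter_eq, ← map_mul, columnIdem_mul_ofStyl, columnIdem_mul_ofStyl,
      ← mul_assoc, h₁, mul_assoc, column_mul_self]
  -- Here `γ c z = d (γ·c) z`. As `z` is heavy, `γ·c` is a proper subset of the first column of
  -- `(γ·c) z`, so the first column of `γ c z` has more letters than `γ`.
  · intro z hz
    rw [mul_assoc, stylLetter_eq, ← map_mul]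
    refine columnIdem_mul_eq_zero fun h' => ?_
    rw [← mul_assoc, h₁, mul_assoc, act_mul, act_mul] at h'
    have hsub := subset_act_column (rightInsert γ c) (act z ∅)
    have hw := hz.trans_le (weight_le_weight_act (column (rightInsert γ c)) (act z ∅))
    have hlt := Finset.card_lt_card (hsub.ssubset_of_ne fun h => hw.ne (congrArg Column.weight h))
    have hle := card_le_card_act (letter d) (act (column (rightInsert γ c)) (act z ∅))
    rw [h'] at hle
    omega

theorem sum_columnIdem : ∑ γ : Column A, columnIdem K γ = 1 := by
  rw [← sum_powerset_coProd_mul (K := K) (Finset.univ : Finset A), Finset.powerset_univ]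
  refine Finset.sum_congr rfl fun γ _ => ?_
  rw [columnIdem_eq, Finset.compl_eq_univ_sdiff]

end Idempotents

end StylAlgebra

/-! ### Path algebras: length filtration and universal property -/

namespace PathAlgebra

variable {K : Type*} [Field K] {V : Type*} [Quiver V]

section Length

variable (K V) in
/-- The span of the paths of length at least `m`. -/
noncomputable def lengthSpan (m : ℕ) : Submodule K (PathAlgebra K V) :=
  Submodule.span K (basis K V '' {p | m ≤ p.2.2.length})

theorem ofPath_mem_lengthSpan {m : ℕ} {a b : V} {p : Quiver.Path a b} (h : m ≤ p.length) :
    ofPath K p ∈ lengthSpan K V m :=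
  Submodule.subset_span ⟨⟨a, b, p⟩, h, rfl⟩

theorem mem_lengthSpan_iff {m : ℕ} {x : PathAlgebra K V} :
    x ∈ lengthSpan K V m ↔
      ∀ p : QuiverPath V, p.2.2.length < m → (basis K V).repr x p = 0 := by
  rw [lengthSpan, Module.Basis.mem_span_image]
  refine ⟨fun h p hp => ?_, fun h p hp => ?_⟩
  · by_contra h'
    exact hp.not_ge (h (Finsupp.mem_support_iff.2 h'))
  · by_contra h'
    exact (Finsupp.mem_support_iff.1 hp) (h p (not_le.1 h'))

theorem lengthSpan_anti {m n : ℕ} (h : m ≤ n) : lengthSpan K V n ≤ lengthSpan K V m :=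
  Submodule.span_mono (Set.image_mono fun _ hp => h.trans hp)

end Length

theorem ofPath_mul_comp {a b c : V} (p : Quiver.Path a b) (q : Quiver.Path b c) :
    ofPath K p * ofPath K q = ofPath K (p.comp q) := mulLin_ofPath_comp p q

theorem ofPath_mul_of_ne {a b c d : V} (p : Quiver.Path a b) (q : Quiver.Path c d) (h : b ≠ c) :
    ofPath K p * ofPath K q = 0 := mulLin_ofPath_of_ne p q h

variable [Fintype V]

section Lift

variable {R : Type*} [Ring R] [Algebra K R]

/-- The algebra homomorphism with given values on the paths. -/
noncomputable def lift (f : ∀ {a b : V}, Quiver.Path a b → R)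
    (one : ∑ v : V, f (Quiver.Path.nil : Quiver.Path v v) = 1)
    (comp : ∀ (a b c : V) (p : Quiver.Path a b) (q : Quiver.Path b c),
      f p * f q = f (p.comp q))
    (ne : ∀ (a b c d : V) (p : Quiver.Path a b) (q : Quiver.Path c d), b ≠ c → f p * f q = 0) :
    PathAlgebra K V →ₐ[K] R :=
  let g : PathAlgebra K V →ₗ[K] R := (basis K V).constr K fun p => f p.2.2
  have hg : ∀ {a b : V} (p : Quiver.Path a b), g (ofPath K p) = f p :=
    fun p => (basis K V).constr_basis K _ _
  AlgHom.ofLinearMap g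
    (by rw [one_def, map_sum, ← one]; exact Finset.sum_congr rfl fun v _ => hg _)
    (by
      intro x y
      refine path_induction (P := fun x => g (x * y) = g x * g y) x (by simp)
        (fun x₁ x₂ h₁ h₂ => by rw [add_mul, map_add, h₁, h₂, map_add, add_mul])
        fun r a b p => ?_
      refine path_induction
        (P := fun y => g (r • ofPath K p * y) = g (r • ofPath K p) * g y) y (by simp)
        (fun x₁ x₂ h₁ h₂ => by rw [mul_add, map_add, h₁, h₂, map_add, mul_add])
        fun s c d q => ?_
      rw [smul_mul_smul_comm, map_smul, map_smul, map_smul, smul_mul_smul_comm, hg, hg]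
      by_cases h : b = c
      · subst h
        rw [ofPath_mul_comp, hg, comp]
      · rw [ofPath_mul_of_ne _ _ h, ne _ _ _ _ _ _ h, map_zero])

theorem lift_ofPath (f : ∀ {a b : V}, Quiver.Path a b → R)
    (one : ∑ v : V, f (Quiver.Path.nil : Quiver.Path v v) = 1)
    (comp : ∀ (a b c : V) (p : Quiver.Path a b) (q : Quiver.Path b c),
      f p * f q = f (p.comp q))
    (ne : ∀ (a b c d : V) (p : Quiver.Path a b) (q : Quiver.Path c d), b ≠ c → f p * f q = 0)
    {a b : V} (p : Quiver.Path a b) : lift (K := K) f one comp ne (ofPath K p) = f p :=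
  (basis K V).constr_basis K _ _

end Lift

section TrivialPart

variable (K V) in
open Classical in
/-- The coefficients of the empty paths, as an algebra homomorphism. -/
noncomputable def nilPart : PathAlgebra K V →ₐ[K] (V → K) :=
  lift (fun {a b} p => if p.length = 0 then Pi.single a 1 else 0)
    (by
      simp only [Quiver.Path.length_nil, if_true]
      exact Finset.univ_sum_single 1)
    (by
      intro a b c p q
      rw [Quiver.Path.length_comp]
      by_cases hp : p.length = 0
      · obtain rfl := Quiver.Path.eq_of_length_zero p hp
        by_cases hq : q.length = 0
        · simp [hp, hq, ← Pi.single_mul]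
        · simp [hp, hq]
      · simp [hp])
    (by
      intro a b c d p q h
      by_cases hp : p.length = 0
      · obtain rfl := Quiver.Path.eq_of_length_zero p hp
        by_cases hq : q.length = 0
        · simp only [hp, hq, if_true]
          ext v
          by_cases hv : v = a
          · subst hv
            simp [h]
          · simp [hv]
        · simp [hq]
      · simp [hp])

open Classical in
theorem nilPart_nil (v : V) :
    nilPart K V (ofPath K (Quiver.Path.nil : Quiver.Path v v)) = Pi.single v 1 := by
  exact (lift_ofPath _ _ _ _ _).trans (by simp)

theorem nilPart_ofPath {a b : V} {p : Quiver.Path a b} (h : p.length ≠ 0) :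
    nilPart K V (ofPath K p) = 0 := by
  exact (lift_ofPath _ _ _ _ _).trans (by simp [h])

theorem nilPart_apply (x : PathAlgebra K V) (v : V) :
    nilPart K V x v = (basis K V).repr x ⟨v, v, Quiver.Path.nil⟩ := by
  classical
  refine path_induction (P := fun x => nilPart K V x v = (basis K V).repr x ⟨v, v, Quiver.Path.nil⟩) x (by simp)
    (fun x₁ x₂ h₁ h₂ => by simp [h₁, h₂]) fun r a b p => ?_
  rw [map_smul, map_smul, Pi.smul_apply, Finsupp.smul_apply, ofPath, Module.Basis.repr_self]
  congr 1
  by_cases hp : p.length = 0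
  · obtain rfl := Quiver.Path.eq_of_length_zero p hp
    obtain rfl := Quiver.Path.eq_nil_of_length_zero p hp
    have := nilPart_nil (K := K) a
    rw [ofPath] at this
    rw [this, Finsupp.single_apply, Pi.single_apply]
    by_cases h : a = v
    · subst h; simp
    · rw [if_neg (Ne.symm h), if_neg]
      intro h'
      exact h (congrArg Sigma.fst h')
  · have := nilPart_ofPath (K := K) hp
    rw [ofPath] at this
    rw [this, Finsupp.single_apply, if_neg, Pi.zero_apply]
    intro h'
    apply hp
    have := congrArg (fun q : QuiverPath V => q.2.2.length) h'
    simpa using this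

theorem nilPart_eq_zero_iff {x : PathAlgebra K V} :
    nilPart K V x = 0 ↔ x ∈ lengthSpan K V 1 := by
  rw [mem_lengthSpan_iff]
  refine ⟨fun h p hp => ?_, fun h => ?_⟩
  · obtain ⟨a, b, p⟩ := p
    have hp : p.length = 0 := by simpa using hp
    obtain rfl := Quiver.Path.eq_of_length_zero p hp
    obtain rfl := Quiver.Path.eq_nil_of_length_zero p hp
    rw [← nilPart_apply, h, Pi.zero_apply]
  · ext v
    rw [nilPart_apply, h _ (by simp), Pi.zero_apply]

theorem nilPart_surjective : Function.Surjective (nilPart K V) := by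
  classical
  intro f
  refine ⟨∑ v, f v • ofPath K (Quiver.Path.nil : Quiver.Path v v), ?_⟩
  simp only [map_sum, map_smul, nilPart_nil]
  ext w
  simp [Finset.sum_apply, Pi.single_apply]

end TrivialPart

section ArrowIdeal

/-- The homomorphism `nilPart` kills the arrows, hence the ideal; conversely a nonempty path is a
multiple of its last arrow. -/
theorem arrowIdeal_toSubspace :
    (arrowIdeal K V).toSubspace K = lengthSpan K V 1 := by
  apply le_antisymm
  · have h : arrowIdeal K V ≤ TwoSidedIdeal.ker (nilPart K V) := by
      rw [arrowIdeal, TwoSidedIdeal.span_le]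
      rintro _ ⟨a, b, f, rfl⟩
      exact TwoSidedIdeal.mem_ker _ |>.2 (nilPart_ofPath (by simp))
    exact fun x hx => nilPart_eq_zero_iff.1 (TwoSidedIdeal.mem_ker _ |>.1 (h hx))
  · refine Submodule.span_le.2 ?_
    rintro _ ⟨⟨a, b, p⟩, hp, rfl⟩
    change ofPath K p ∈ arrowIdeal K V
    cases p with
    | nil => simp at hp
    | cons q f =>
      have : ofPath K (q.cons f) = ofPath K q * ofPath K f.toPath := by
        rw [ofPath_mul_comp]; rfl
      rw [this]
      exact TwoSidedIdeal.mul_mem_left _ _ _ (TwoSidedIdeal.subset_span ⟨_, _, f, rfl⟩)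

theorem lengthSpan_mul_lengthSpan_one (m : ℕ) :
    lengthSpan K V m * lengthSpan K V 1 = lengthSpan K V (m + 1) := by
  apply le_antisymm
  · rw [lengthSpan, lengthSpan, Submodule.span_mul_span, Submodule.span_le]
    rintro _ ⟨_, ⟨⟨a, b, p⟩, hp, rfl⟩, _, ⟨⟨c, d, q⟩, hq, rfl⟩, rfl⟩
    change ofPath K p * ofPath K q ∈ lengthSpan K V (m + 1)
    by_cases h : b = c
    · subst h
      rw [ofPath_mul_comp]
      refine ofPath_mem_lengthSpan ?_
      rw [Quiver.Path.length_comp]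
      exact Nat.add_le_add hp hq
    · rw [ofPath_mul_of_ne _ _ h]
      exact zero_mem _
  · refine Submodule.span_le.2 ?_
    rintro _ ⟨⟨a, b, p⟩, hp, rfl⟩
    change ofPath K p ∈ lengthSpan K V m * lengthSpan K V 1
    cases p with
    | nil => simp at hp
    | cons q f =>
      have : ofPath K (q.cons f) = ofPath K q * ofPath K f.toPath := by
        rw [ofPath_mul_comp]; rfl
      rw [this]
      refine Submodule.mul_mem_mul (ofPath_mem_lengthSpan ?_) (ofPath_mem_lengthSpan (by simp))
      simpa using hp

theorem lengthSpan_one_pow {m : ℕ} (hm : 1 ≤ m) :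
    lengthSpan K V 1 ^ m = lengthSpan K V m := by
  induction m, hm using Nat.le_induction with
  | base => exact pow_one _
  | succ m hm ih => rw [pow_succ, ih, lengthSpan_mul_lengthSpan_one]

theorem arrowIdeal_toSubspace_pow {m : ℕ} (hm : 1 ≤ m) :
    (arrowIdeal K V).toSubspace K ^ m = lengthSpan K V m := by
  rw [arrowIdeal_toSubspace, lengthSpan_one_pow hm]

end ArrowIdeal

end PathAlgebra

/-! ### The quiver of an admissible quotient -/

section OrdinaryQuiverOfAdmissible

open PathAlgebra

variable {K : Type*} [Field K] {V : Type*} [Quiver V] [Fintype V] {R : Type*} [Ring R]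
  [Algebra K R]

theorem mem_jacobson_of_forall_isNilpotent {I : Ideal R} (h : ∀ x ∈ I, IsNilpotent x) {x : R}
    (hx : x ∈ I) : x ∈ Ring.jacobson R := by
  rw [← Ideal.jacobson_bot, Ideal.mem_jacobson_iff]
  intro y
  obtain ⟨z, hz⟩ := (h _ (I.mul_mem_left y hx)).isUnit_one_add.exists_left_inv
  refine ⟨z, ?_⟩
  rw [Ideal.mem_bot, mul_assoc, sub_eq_zero, ← hz]
  noncomm_ring

/-- A nilpotent idempotent is zero, so `χ` detects whether an idempotent vanishes, and a single
coordinate of `V → K` cannot be split. -/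
theorem isPrimitiveIdempotent_of_map_eq_single {K V R : Type*} [Field K] [Ring R] [Algebra K R]
    [DecidableEq V] (χ : R →ₐ[K] (V → K))
    (hχ : ∀ x, χ x = 0 → IsNilpotent x) {e : R} (he : IsIdempotentElem e) {v : V}
    (hv : χ e = Pi.single v 1) : IsPrimitiveIdempotent e := by
  have hzero : ∀ x : R, IsIdempotentElem x → χ x = 0 → x = 0 := by
    intro x hx h
    obtain ⟨n, hn⟩ := hχ x h
    rcases Nat.eq_zero_or_pos n with rfl | hpos
    · rw [pow_zero] at hn
      rw [← mul_one x, hn, mul_zero]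
    · obtain ⟨k, rfl⟩ := Nat.exists_eq_succ_of_ne_zero hpos.ne'
      rwa [hx.pow_succ_eq] at hn
  refine ⟨he, ?_, ?_⟩
  · rintro rfl
    have := congrFun hv v
    simp at this
  · intro x y hx hy hxy _ hsum
    have hmul : ∀ w, χ x w * χ y w = 0 := fun w => by
      rw [← Pi.mul_apply, ← map_mul, hxy, map_zero, Pi.zero_apply]
    have hadd : ∀ w, (Pi.single v 1 : V → K) w = χ x w + χ y w := fun w => by
      rw [← hv, hsum, map_add, Pi.add_apply]
    have hoff : ∀ w, w ≠ v → χ x w = 0 ∧ χ y w = 0 := by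
      intro w hw
      have h := hadd w
      rw [Pi.single_eq_of_ne hw] at h
      rcases mul_eq_zero.1 (hmul w) with h' | h'
      · rw [h', zero_add] at h
        exact ⟨h', h.symm⟩
      · rw [h', add_zero] at h
        exact ⟨h.symm, h'⟩
    rcases mul_eq_zero.1 (hmul v) with h | h
    · left
      refine hzero x hx (funext fun w => ?_)
      by_cases hw : w = v
      · rw [hw, h, Pi.zero_apply]
      · exact (hoff w hw).1
    · right
      refine hzero y hy (funext fun w => ?_)
      by_cases hw : w = v
      · rw [hw, h, Pi.zero_apply]
      · exact (hoff w hw).2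

/-- A quotient of a path algebra by an admissible ideal has the ordinary quiver one started
from. -/
theorem isOrdinaryQuiver_of_isAdmissible [Module.Finite K R] [hfin : ∀ v w : V, Finite (v ⟶ w)]
    (φ : PathAlgebra K V →ₐ[K] R) (hφ : Function.Surjective φ)
    (h : IsAdmissible (TwoSidedIdeal.ker φ)) :
    IsOrdinaryQuiver K R V fun v => φ (ofPath K (Quiver.Path.nil : Quiver.Path v v)) := by
  classical
  obtain ⟨⟨m, hm, h₁⟩, h₂⟩ := h
  rw [arrowIdeal_toSubspace_pow (by omega)] at h₁ h₂
  have hker₁ : ∀ x ∈ lengthSpan K V m, φ x = 0 := fun x hx =>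
    TwoSidedIdeal.mem_ker φ |>.1 (h₁ hx)
  have hker₂ : ∀ x, φ x = 0 → x ∈ lengthSpan K V 2 := fun x hx =>
    h₂ (TwoSidedIdeal.mem_ker φ |>.2 hx)
  have hker : ∀ x, φ x = 0 → nilPart K V x = 0 := fun x hx =>
    nilPart_eq_zero_iff.2 (lengthSpan_anti one_le_two (hker₂ x hx))
  -- As the kernel of `φ` lies in `F ^ 2 ⊆ F`, the map `nilPart` descends to `R`. The kernel of `χ`
  -- is the image of `F`, which is nilpotent because `F ^ m` maps to zero; it will be the radical.
  obtain ⟨χ, hχ⟩ : ∃ χ : R →ₐ[K] (V → K), ∀ x, χ (φ x) = nilPart K V x := by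
    set ψ := Ideal.Quotient.liftₐ (RingHom.ker φ) (nilPart K V) fun x hx => hker x hx
    refine ⟨ψ.comp (Ideal.quotientKerAlgEquivOfSurjective hφ).symm.toAlgHom, fun x => ?_⟩
    have : (Ideal.quotientKerAlgEquivOfSurjective hφ).symm (φ x) =
        Ideal.Quotient.mk (RingHom.ker φ) x :=
      Ideal.quotientKerAlgEquivOfSurjective_symm_apply hφ x
    change ψ ((Ideal.quotientKerAlgEquivOfSurjective hφ).symm (φ x)) = _
    rw [this]
    rfl
  have hχs : Function.Surjective χ := fun f => by
    obtain ⟨x, rfl⟩ := nilPart_surjective f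
    exact ⟨φ x, hχ x⟩
  have hnil : ∀ x, χ x = 0 → IsNilpotent x := by
    intro x hx
    obtain ⟨y, rfl⟩ := hφ x
    rw [hχ, nilPart_eq_zero_iff] at hx
    refine ⟨m, ?_⟩
    rw [← map_pow]
    apply hker₁
    rw [← lengthSpan_one_pow (by omega)]
    exact Submodule.pow_mem_pow _ hx m
  have hJ : Ring.jacobson R = RingHom.ker χ := by
    apply le_antisymm
    · have : RingHomSurjective (χ : R →+* (V → K)) := ⟨hχs⟩
      have := Ring.le_comap_jacobson (χ : R →+* (V → K))
      rwa [IsSemisimpleRing.jacobson_eq_bot (V → K)] at this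
    · exact fun x hx => mem_jacobson_of_forall_isNilpotent (I := RingHom.ker χ)
        (fun x hx => hnil x hx) hx
  have hrad : radSubspace K R = (lengthSpan K V 1).map φ.toLinearMap := by
    ext x
    change x ∈ Ring.jacobson R ↔ _
    rw [hJ, RingHom.mem_ker, Submodule.mem_map]
    constructor
    · intro hx
      obtain ⟨y, rfl⟩ := hφ x
      rw [hχ, nilPart_eq_zero_iff] at hx
      exact ⟨y, hx, rfl⟩
    · rintro ⟨y, hy, rfl⟩
      exact (hχ y).trans (nilPart_eq_zero_iff.2 hy)
  have hrad₂ : radSubspace K R ^ 2 = (lengthSpan K V 2).map φ.toLinearMap := by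
    rw [hrad, ← lengthSpan_one_pow one_le_two, Submodule.map_pow]
  have hcompl : CompleteOrthogonalIdempotents
      fun v => φ (ofPath K (Quiver.Path.nil : Quiver.Path v v)) := by
    rw [CompleteOrthogonalIdempotents.iff_ortho_complete]
    refine ⟨fun v w hvw => ?_, ?_⟩
    · change φ _ * φ _ = 0
      rw [← map_mul, ofPath_mul_of_ne _ _ hvw, map_zero]
    · rw [← map_sum, ← one_def, map_one]
  refine ⟨inferInstance, ?_, hcompl, fun v => ?_, hfin, fun v w => ?_⟩
  · have hiso : ∀ (I : Ideal R) [I.IsTwoSided], I = RingHom.ker χ →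
        Nonempty ((R ⧸ I) ≃ₐ[K] (V → K)) := by
      rintro I _ rfl
      exact ⟨Ideal.quotientKerAlgEquivOfSurjective hχs⟩
    exact hiso _ hJ
  · exact isPrimitiveIdempotent_of_map_eq_single χ hnil (hcompl.idem v)
      ((hχ _).trans (nilPart_nil v))
  -- The arrows give a basis of the arrow space. A relation among them modulo `J ^ 2` lifts to a
  -- combination of arrows in `F ^ 2` plus the kernel of `φ`, which is again in `F ^ 2`; so its
  -- coefficients vanish.
  · set b : (v ⟶ w) → R ⧸ radSubspace K R ^ 2 :=
      fun f => (radSubspace K R ^ 2).mkQ (φ (ofPath K f.toPath)) with hb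
    have := Fintype.ofFinite (v ⟶ w)
    have hli : LinearIndependent K b := by
      rw [Fintype.linearIndependent_iff]
      intro g hg f
      have hsum : (radSubspace K R ^ 2).mkQ (φ (∑ f, g f • ofPath K f.toPath)) = 0 := by
        rw [← hg, map_sum, map_sum]
        simp only [map_smul, hb]
      rw [Submodule.mkQ_apply, Submodule.Quotient.mk_eq_zero, hrad₂] at hsum
      obtain ⟨y, hy, hy'⟩ := hsum
      have hmem := hker₂ ((∑ f, g f • ofPath K f.toPath) - y) (by
        rw [map_sub, sub_eq_zero]; exact hy'.symm)
      have hmem' := add_mem hmem hy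
      rw [sub_add_cancel, mem_lengthSpan_iff] at hmem'
      have h₀ := hmem' ⟨v, w, f.toPath⟩ (by simp)
      rw [map_sum, Finsupp.finsetSum_apply, Finset.sum_eq_single f] at h₀
      · simpa [ofPath] using h₀
      · intro f' _ hne
        rw [map_smul, Finsupp.smul_apply, ofPath, Module.Basis.repr_self,
          Finsupp.single_eq_of_ne, smul_zero]
        intro heq
        apply hne
        simpa [Quiver.Hom.toPath] using heq.symm
      · exact fun h => absurd (Finset.mem_univ f) h
    have hspan : arrowSpace K (φ (ofPath K (Quiver.Path.nil : Quiver.Path v v)))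
        (φ (ofPath K (Quiver.Path.nil : Quiver.Path w w))) = Submodule.span K (Set.range b) := by
      rw [arrowSpace, congrArg (Submodule.map _) hrad, ← Submodule.map_comp, ← Submodule.map_comp]
      apply le_antisymm
      · rw [lengthSpan, Submodule.map_span_le]
        rintro _ ⟨⟨c, d, p⟩, hp, rfl⟩
        change (radSubspace K R ^ 2).mkQ (φ _ * (φ (ofPath K p) * φ _)) ∈ _
        rw [← map_mul, ← map_mul]
        by_cases hd : d = w
        · subst hd
          rw [ofPath_mul_comp, Quiver.Path.comp_nil]
          by_cases hc : v = c
          · subst hc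
            rw [ofPath_mul_comp, Quiver.Path.nil_comp]
            by_cases hlen : 2 ≤ p.length
            · have : (radSubspace K R ^ 2).mkQ (φ (ofPath K p)) = 0 := by
                rw [Submodule.mkQ_apply, Submodule.Quotient.mk_eq_zero, hrad₂]
                exact ⟨_, ofPath_mem_lengthSpan hlen, rfl⟩
              rw [this]
              exact zero_mem _
            · cases p with
              | nil => simp at hp
              | cons q f =>
                cases q with
                | nil => exact Submodule.subset_span ⟨f, rfl⟩
                | cons q f' =>
                  exfalso
                  apply hlen
                  simp only [Quiver.Path.length_cons]
                  omega
          · rw [ofPath_mul_of_ne _ _ hc, map_zero, map_zero]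
            exact zero_mem _
        · rw [ofPath_mul_of_ne _ _ hd, mul_zero, map_zero, map_zero]
          exact zero_mem _
      · rw [Submodule.span_le]
        rintro _ ⟨f, rfl⟩
        refine ⟨ofPath K f.toPath, ofPath_mem_lengthSpan (by simp), ?_⟩
        change (radSubspace K R ^ 2).mkQ (φ _ * (φ (ofPath K f.toPath) * φ _)) = _
        rw [← map_mul, ← map_mul, ofPath_mul_comp, Quiver.Path.comp_nil, ofPath_mul_comp,
          Quiver.Path.nil_comp]
    rw [hspan, finrank_span_eq_card hli, Nat.card_eq_fintype_card]

end OrdinaryQuiverOfAdmissible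

/-! ### Classes of paths in `Q(A)` -/

namespace StylicQuiver

open Styl StylAlgebra PathAlgebra

variable {K : Type*} [Field K] {A : Type*} [LinearOrder A] {γ δ ε : StylicQuiver A}

/-- A vertex of `Q(A)`, as a column. -/
def toColumn {A : Type*} (γ : StylicQuiver A) : Column A := γ

theorem toColumn_inj {A : Type*} {γ δ : StylicQuiver A} : γ.toColumn = δ.toColumn ↔ γ = δ :=
  Iff.rfl

theorem isFrank_arrowLabel (f : γ ⟶ δ) : IsFrank γ.toColumn (arrowLabel f) := f.2.1

theorem rightInsert_arrowLabel (f : γ ⟶ δ) : rightInsert γ.toColumn (arrowLabel f) = δ.toColumn :=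
  f.2.2

section Labels

theorem pathLabel_comp (p : Quiver.Path γ δ) (q : Quiver.Path δ ε) :
    pathLabel (p.comp q) = pathLabel p * pathLabel q := by
  induction q with
  | nil => exact (mul_one _).symm
  | cons q f ih =>
    rw [Quiver.Path.comp_cons]
    change pathLabel (p.comp q) * _ = _
    rw [ih, mul_assoc]
    rfl

/-- The class of the word formed by the start and the label of a path. -/
def pathClass (p : Quiver.Path γ δ) : Styl A := column γ.toColumn * toStyl (pathLabel p)

theorem toStyl_columnWord_mul_pathLabel (p : Quiver.Path γ δ) :
    toStyl (columnWord γ.toColumn * pathLabel p) = pathClass p := by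
  rw [map_mul]; rfl

theorem pathClass_nil (γ : StylicQuiver A) :
    pathClass (Quiver.Path.nil : Quiver.Path γ γ) = column γ.toColumn := mul_one _

theorem pathClass_cons (p : Quiver.Path γ δ) (f : δ ⟶ ε) :
    pathClass (p.cons f) = pathClass p * letter (arrowLabel f) := by
  rw [pathClass, pathLabel, map_mul, ← mul_assoc]; rfl

/-- Each frank step trades its label for a letter on the left of the column, and inserting these
letters again leads from the target back to the start. -/
theorem exists_pathClass_eq_mul_column (p : Quiver.Path γ δ) :
    ∃ u : Styl A, pathClass p = u * column δ.toColumn ∧ act u δ.toColumn = γ.toColumn := by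
  induction p with
  | nil => exact ⟨1, by rw [pathClass_nil, one_mul], rfl⟩
  | cons p f ih =>
    obtain ⟨u, hu, hact⟩ := ih
    obtain ⟨d, -, -, h₁, h₂, -⟩ := exists_of_isFrank (isFrank_arrowLabel f)
    rw [rightInsert_arrowLabel] at h₁ h₂
    refine ⟨u * letter d, ?_, ?_⟩
    · rw [pathClass_cons, hu, mul_assoc, mul_assoc, ← h₁]
    · rw [act_mul, act_letter, h₂, hact]

theorem act_pathClass_empty (p : Quiver.Path γ δ) : act (pathClass p) ∅ = γ.toColumn := by
  obtain ⟨u, hu, hact⟩ := exists_pathClass_eq_mul_column p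
  rw [hu, act_mul, act_column_empty, hact]

theorem length_add_weight_le [Fintype A] (p : Quiver.Path γ δ) :
    p.length + Column.weight δ.toColumn ≤ Column.weight γ.toColumn := by
  induction p with
  | nil => simp
  | cons p f ih =>
    have := weight_rightInsert_lt (isFrank_arrowLabel f)
    rw [rightInsert_arrowLabel] at this
    rw [Quiver.Path.length_cons]
    omega

theorem eq_nil_of_loop [Fintype A] (p : Quiver.Path γ γ) : p = Quiver.Path.nil := by
  have := length_add_weight_le p
  exact Quiver.Path.eq_nil_of_length_zero p (by omega)

theorem eq_of_pathClass_eq [Fintype A] {p q : Quiver.Path γ δ} (hp : p.length ≤ 1)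
    (h : pathClass p = pathClass q) : p = q := by
  cases p with
  | nil => exact (eq_nil_of_loop q).symm
  | cons p f =>
    obtain rfl := Quiver.Path.eq_of_length_zero p (by simpa using hp)
    obtain rfl := Quiver.Path.eq_nil_of_length_zero p (by simpa using hp)
    rcases Nat.eq_zero_or_pos q.length with hq | hq
    · obtain rfl := Quiver.Path.eq_of_length_zero q hq
      exact absurd (congrArg Quiver.Path.length (eq_nil_of_loop (Quiver.Path.nil.cons f)))
        (by simp)
    obtain ⟨η, g, q, -, rfl⟩ :=
      q.eq_toPath_comp_of_length_eq_succ (Nat.succ_pred_eq_of_pos hq).symm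
    rw [pathClass_cons, pathClass_nil, pathClass, pathLabel_comp, map_mul, ← mul_assoc] at h
    change column γ.toColumn * letter (arrowLabel f) =
      column γ.toColumn * letter (arrowLabel g) * toStyl (pathLabel q) at h
    -- The class of the arrow `f` fixes the column `γ ∪ {f}`, so every letter of the other word
    -- fixes it too. Thus the first label `g` lies in `γ ∪ {f}`, and frankness excludes `γ`.
    have hfix : act (column γ.toColumn * letter (arrowLabel f))
        (insert (arrowLabel f) γ.toColumn) = insert (arrowLabel f) γ.toColumn :=
      act_mul_eq_self_iff.2 ⟨act_column_eq_self_iff.2 (Finset.subset_insert _ _),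
        leftInsert_of_mem (Finset.mem_insert_self _ _)⟩
    rw [h] at hfix
    have hmem := leftInsert_eq_self_iff.1 (act_mul_eq_self_iff.1 (act_mul_eq_self_iff.1 hfix).1).2
    have hfg : arrowLabel g = arrowLabel f :=
      (Finset.mem_insert.1 hmem).resolve_right (isFrank_arrowLabel g).2
    obtain rfl : η = δ := toColumn_inj.1 (by
      rw [← rightInsert_arrowLabel f, ← rightInsert_arrowLabel g, hfg])
    obtain rfl : g = f := Subtype.ext hfg
    rw [eq_nil_of_loop q, Quiver.Path.comp_nil]
    rfl

end Labels

/-! ### Values of paths, the kernel and its admissibility -/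

section Values

variable [Fintype A]

theorem pathValue_cons (p : Quiver.Path γ δ) (f : δ ⟶ ε) :
    pathValue K (p.cons f) =
      pathValue K p * stylLetter K (arrowLabel f) * columnIdem K ε.toColumn := rfl

theorem pathValue_mul_columnIdem (p : Quiver.Path γ δ) :
    pathValue K p * columnIdem K δ.toColumn = pathValue K p := by
  cases p with
  | nil => exact columnIdem_mul_self _
  | cons p f => rw [pathValue_cons, mul_assoc, columnIdem_mul_self]

theorem columnIdem_mul_pathValue (p : Quiver.Path γ δ) :
    columnIdem K γ.toColumn * pathValue K p = pathValue K p := by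
  induction p with
  | nil => exact columnIdem_mul_self _
  | cons p f ih => rw [pathValue_cons, ← mul_assoc, ← mul_assoc, ih]

/-- By frankness the new idempotent is already implied, so only the one at the start of a path
matters. -/
theorem pathValue_cons_eq (p : Quiver.Path γ δ) (f : δ ⟶ ε) :
    pathValue K (p.cons f) = pathValue K p * stylLetter K (arrowLabel f) := by
  have h := columnIdem_mul_letter_mul (K := K) (isFrank_arrowLabel f)
  rw [rightInsert_arrowLabel] at h
  rw [pathValue_cons, ← pathValue_mul_columnIdem p, mul_assoc _ _ (stylLetter K _), mul_assoc, h]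

theorem pathValue_eq (p : Quiver.Path γ δ) :
    pathValue K p = columnIdem K γ.toColumn * ofStyl K (toStyl (pathLabel p)) := by
  induction p with
  | nil =>
    change columnIdem K γ.toColumn = columnIdem K γ.toColumn * ofStyl K 1
    rw [map_one, mul_one]
  | cons p f ih =>
    rw [pathValue_cons_eq, ih, pathLabel, map_mul, map_mul, ← mul_assoc]
    rfl

theorem pathValue_eq_of_pathClass_eq {δ' : StylicQuiver A} {p : Quiver.Path γ δ}
    {q : Quiver.Path γ δ'} (h : pathClass p = pathClass q) : pathValue K p = pathValue K q := by
  rw [pathValue_eq, pathValue_eq, columnIdem_mul_ofStyl, columnIdem_mul_ofStyl]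
  exact congrArg (fun z => _ * ofStyl K z) h

theorem firstColumnPart_pathValue (p : Quiver.Path γ δ) :
    firstColumnPart K γ.toColumn (pathValue K p) = ofStyl K (pathClass p) := by
  rw [pathValue_eq]
  exact firstColumnPart_columnIdem_mul (act_pathClass_empty p)

theorem pathValue_ne_zero (p : Quiver.Path γ δ) : pathValue K p ≠ 0 := by
  intro h
  have := firstColumnPart_pathValue (K := K) p
  rw [h, map_zero] at this
  exact linearIndependent_ofStyl.ne_zero _ this.symm

theorem pathValue_mul_of_ne {ζ : StylicQuiver A} (p : Quiver.Path γ δ) (q : Quiver.Path ε ζ)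
    (h : δ ≠ ε) : pathValue K p * pathValue K q = 0 := by
  have h' : columnIdem K δ.toColumn * columnIdem K ε.toColumn = 0 := columnIdem_mul_of_ne h
  rw [← pathValue_mul_columnIdem p, ← columnIdem_mul_pathValue q, mul_assoc,
    ← mul_assoc (columnIdem K _) (columnIdem K _), h', zero_mul, mul_zero]

theorem pathValue_mul_comp (p : Quiver.Path γ δ) (q : Quiver.Path δ ε) :
    pathValue K p * pathValue K q = pathValue K (p.comp q) := by
  induction q with
  | nil => exact pathValue_mul_columnIdem p
  | cons q f ih =>
    rw [Quiver.Path.comp_cons, pathValue_cons, pathValue_cons, ← ih]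
    simp only [mul_assoc]

/-- The common value is nonzero and is fixed on the right by the idempotents of both targets, which
are orthogonal if distinct. -/
theorem eq_target_of_pathClass_eq (K : Type*) [Field K] {δ' : StylicQuiver A}
    {p : Quiver.Path γ δ} {q : Quiver.Path γ δ'} (h : pathClass p = pathClass q) : δ = δ' := by
  by_contra hne
  have h' : columnIdem K δ'.toColumn * columnIdem K δ.toColumn = 0 :=
    columnIdem_mul_of_ne (Ne.symm hne)
  apply pathValue_ne_zero (K := K) p
  rw [← pathValue_mul_columnIdem p, pathValue_eq_of_pathClass_eq h, ← pathValue_mul_columnIdem q,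
    mul_assoc, h', mul_zero]

/-- A letter on the right of a path value extends the path, is absorbed, or gives zero; so the span
of the values is a right ideal. -/
theorem pathValue_mul_mem {S : Submodule K (StylAlgebra K A)}
    (hS : ∀ (γ δ : StylicQuiver A) (p : Quiver.Path γ δ), pathValue K p ∈ S) (z : Styl A) :
    ∀ (γ δ : StylicQuiver A) (p : Quiver.Path γ δ), pathValue K p * ofStyl K z ∈ S := by
  induction z using letter_mul_induction with
  | one =>
    intro γ δ p
    rw [map_one, mul_one]
    exact hS _ _ p
  | mul c z ih =>
    intro γ δ p
    rw [map_mul, ← mul_assoc, ← stylLetter_eq]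
    by_cases hf : IsFrank δ.toColumn c
    · let f : δ ⟶ (show StylicQuiver A from rightInsert δ.toColumn c) := ⟨c, hf, rfl⟩
      have := ih _ _ (p.cons f)
      rwa [pathValue_cons_eq] at this
    · by_cases hc : c ∈ δ.toColumn
      · have h : columnIdem K δ.toColumn * stylLetter K c = columnIdem K δ.toColumn :=
          columnIdem_mul_letter_of_mem hc
        rw [← pathValue_mul_columnIdem p, mul_assoc (pathValue K p), h,
          pathValue_mul_columnIdem]
        exact ih _ _ p
      · have h : columnIdem K δ.toColumn * stylLetter K c = 0 :=
          columnIdem_mul_letter_of_not_isFrank hc hf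
        rw [← pathValue_mul_columnIdem p, mul_assoc (pathValue K p), h, mul_zero, zero_mul]
        exact zero_mem _

theorem eq_top_of_pathValue_mem {S : Submodule K (StylAlgebra K A)}
    (hS : ∀ (γ δ : StylicQuiver A) (p : Quiver.Path γ δ), pathValue K p ∈ S) : S = ⊤ := by
  rw [eq_top_iff, ← span_ofStyl, Submodule.span_le]
  rintro _ ⟨z, rfl⟩
  rw [← one_mul (ofStyl K z), ← sum_columnIdem, Finset.sum_mul]
  exact Submodule.sum_mem _ fun γ _ =>
    pathValue_mul_mem hS z γ γ (Quiver.Path.nil : Quiver.Path (V := StylicQuiver A) γ γ)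

variable (K A) in
/-- The homomorphism from the path algebra of `Q(A)` to the stylic algebra. -/
noncomputable def pathHom : PathAlgebra K (StylicQuiver A) →ₐ[K] StylAlgebra K A :=
  PathAlgebra.lift (fun {_ _} p => pathValue K p) sum_columnIdem
    (fun _ _ _ p q => pathValue_mul_comp p q) (fun _ _ _ _ p q h => pathValue_mul_of_ne p q h)

theorem pathHom_ofPath (p : Quiver.Path γ δ) : pathHom K A (ofPath K p) = pathValue K p :=
  PathAlgebra.lift_ofPath _ _ _ _ p

theorem pathHom_surjective : Function.Surjective (pathHom K A) := by
  have : LinearMap.range (pathHom K A).toLinearMap = ⊤ :=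
    eq_top_of_pathValue_mem fun _ _ p => ⟨ofPath K p, pathHom_ofPath p⟩
  exact LinearMap.range_eq_top.1 this

variable (K A) in
/-- The span of the differences of two paths with the same start and the same class. -/
noncomputable def relationSpan : Submodule K (PathAlgebra K (StylicQuiver A)) :=
  Submodule.span K {x | ∃ (γ δ₁ δ₂ : StylicQuiver A) (p : Quiver.Path γ δ₁) (q : Quiver.Path γ δ₂),
    toStyl (columnWord γ.toColumn * pathLabel p) = toStyl (columnWord γ.toColumn * pathLabel q) ∧
      x = ofPath K p - ofPath K q}

theorem ofPath_sub_ofPath_mem {δ' : StylicQuiver A} {p : Quiver.Path γ δ} {q : Quiver.Path γ δ'}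
    (h : pathClass p = pathClass q) : ofPath K p - ofPath K q ∈ relationSpan K A :=
  Submodule.subset_span ⟨γ, δ, δ', p, q, by
    rw [toStyl_columnWord_mul_pathLabel, toStyl_columnWord_mul_pathLabel, h], rfl⟩

theorem relationSpan_le {S : Submodule K (PathAlgebra K (StylicQuiver A))}
    (h : ∀ (γ δ₁ δ₂ : StylicQuiver A) (p : Quiver.Path γ δ₁) (q : Quiver.Path γ δ₂),
      pathClass p = pathClass q → ofPath K p - ofPath K q ∈ S) : relationSpan K A ≤ S := by
  refine Submodule.span_le.2 ?_
  rintro _ ⟨γ, δ₁, δ₂, p, q, hpq, rfl⟩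
  rw [toStyl_columnWord_mul_pathLabel, toStyl_columnWord_mul_pathLabel] at hpq
  exact h γ δ₁ δ₂ p q hpq

/-- Well defined because paths from `γ` of equal class agree modulo the relations; elements that are
not classes of such paths may be sent to `0`. -/
theorem exists_section (γ : StylicQuiver A) :
    ∃ σ : StylAlgebra K A →ₗ[K] PathAlgebra K (StylicQuiver A) ⧸ relationSpan K A,
      ∀ (δ : StylicQuiver A) (p : Quiver.Path γ δ),
        σ (ofStyl K (pathClass p)) = (relationSpan K A).mkQ (ofPath K p) := by
  classical
  have hex : ∀ z : Styl A, ∃ y : PathAlgebra K (StylicQuiver A) ⧸ relationSpan K A,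
      ∀ (δ : StylicQuiver A) (p : Quiver.Path γ δ), pathClass p = z →
        y = (relationSpan K A).mkQ (ofPath K p) := by
    intro z
    by_cases h : ∃ (δ : StylicQuiver A) (p : Quiver.Path γ δ), pathClass p = z
    · obtain ⟨δ, p, rfl⟩ := h
      refine ⟨(relationSpan K A).mkQ (ofPath K p), fun δ' q hq => ?_⟩
      rw [← sub_eq_zero, ← map_sub, Submodule.mkQ_apply, Submodule.Quotient.mk_eq_zero]
      exact ofPath_sub_ofPath_mem hq.symm
    · exact ⟨0, fun δ p hp => absurd ⟨δ, p, hp⟩ h⟩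
  choose y hy using hex
  exact ⟨(MonoidAlgebra.basis (Styl A) K).constr K y, fun δ p =>
    ((MonoidAlgebra.basis (Styl A) K).constr_basis K y _).trans (hy _ δ p rfl)⟩

/-- Modulo the relations, `x` is recovered from its image: `e γ` selects the paths from `γ`,
`firstColumnPart` turns their values into classes, and `σ γ` turns classes back into paths. -/
theorem mem_relationSpan_of_pathHom_eq_zero {x : PathAlgebra K (StylicQuiver A)}
    (hx : pathHom K A x = 0) : x ∈ relationSpan K A := by
  choose σ hσ using exists_section (K := K) (A := A)
  have key : (relationSpan K A).mkQ x =
      ∑ γ : StylicQuiver A,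
        σ γ (firstColumnPart K γ.toColumn (columnIdem K γ.toColumn * pathHom K A x)) := by
    refine path_induction (P := fun x => (relationSpan K A).mkQ x =
      ∑ γ : StylicQuiver A, σ γ (firstColumnPart K γ.toColumn (columnIdem K γ.toColumn * pathHom K A x)))
      x (by simp) (fun x y h₁ h₂ => ?_) fun r γ δ p => ?_
    · rw [map_add, h₁, h₂, ← Finset.sum_add_distrib]
      refine Finset.sum_congr rfl fun γ _ => ?_
      rw [map_add, mul_add, map_add, map_add]
    · rw [Finset.sum_eq_single γ]
      · rw [map_smul, map_smul, mul_smul_comm, map_smul, map_smul, pathHom_ofPath,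
          columnIdem_mul_pathValue, firstColumnPart_pathValue, hσ]
      · intro ε _ hε
        have h : columnIdem K ε.toColumn * columnIdem K γ.toColumn = 0 := columnIdem_mul_of_ne hε
        rw [map_smul, pathHom_ofPath, ← columnIdem_mul_pathValue, mul_smul_comm, ← mul_assoc, h,
          zero_mul, smul_zero, map_zero, map_zero]
      · exact fun h => absurd (Finset.mem_univ γ) h
  rw [← Submodule.Quotient.mk_eq_zero, ← Submodule.mkQ_apply, key, hx]
  simp

theorem ker_pathHom : (TwoSidedIdeal.ker (pathHom K A)).toSubspace K = relationSpan K A := by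
  apply le_antisymm
  · exact fun x hx => mem_relationSpan_of_pathHom_eq_zero (TwoSidedIdeal.mem_ker _ |>.1 hx)
  · refine relationSpan_le fun γ δ₁ δ₂ p q h => TwoSidedIdeal.mem_ker _ |>.2 ?_
    rw [map_sub, pathHom_ofPath, pathHom_ofPath, pathValue_eq_of_pathClass_eq h, sub_self]

theorem isAdmissible_ker_pathHom : IsAdmissible (TwoSidedIdeal.ker (pathHom K A)) := by
  rw [IsAdmissible, ker_pathHom]
  constructor
  -- No path is longer than the weight of the full column, so no path has length `m`; the summand
  -- `2` also ensures `2 ≤ m`.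
  · refine ⟨Column.weight (Finset.univ : Finset A) + 2, by omega, ?_⟩
    rw [arrowIdeal_toSubspace_pow (by omega)]
    refine Submodule.span_le.2 ?_
    rintro _ ⟨⟨γ, δ, p⟩, hp, rfl⟩
    have h₁ := length_add_weight_le p
    have h₂ : Column.weight γ.toColumn ≤ _ := Column.weight_mono (Finset.subset_univ _)
    change _ ≤ p.length at hp
    omega
  · rw [arrowIdeal_toSubspace_pow one_le_two]
    refine relationSpan_le fun γ δ₁ δ₂ p q h => ?_
    obtain rfl := eq_target_of_pathClass_eq K h
    -- If either path is shorter than `2`, the two paths coincide and the difference is zero.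
    by_cases hp : 2 ≤ p.length
    · by_cases hq : 2 ≤ q.length
      · exact sub_mem (ofPath_mem_lengthSpan hp) (ofPath_mem_lengthSpan hq)
      · rw [eq_of_pathClass_eq (by omega) h.symm, sub_self]
        exact zero_mem _
    · rw [eq_of_pathClass_eq (by omega) h, sub_self]
      exact zero_mem _

theorem finite_stylAlgebra : Module.Finite K (StylAlgebra K A) := by
  have : Finite (Function.End (Column A)) := inferInstanceAs (Finite (Column A → Column A))
  exact Module.Finite.of_basis (MonoidAlgebra.basis (Styl A) K)

theorem finite_hom (γ δ : StylicQuiver A) : Finite (γ ⟶ δ) :=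
  inferInstanceAs
    (Finite {c : A // IsFrank (γ : Column A) c ∧ rightInsert (γ : Column A) c = δ})

end Values

end StylicQuiver

theorem theorem4 (K : Type*) [Field K] [CharZero K] (A : Type*) [LinearOrder A] [Fintype A] :
    IsOrdinaryQuiver K (StylAlgebra K A) (StylicQuiver A) (fun γ => columnIdem K γ) ∧
      ∃ φ : PathAlgebra K (StylicQuiver A) →ₐ[K] StylAlgebra K A,
        (∀ (γ δ : StylicQuiver A) (p : Quiver.Path γ δ),
          φ (PathAlgebra.ofPath K p) = pathValue K p) ∧
        Function.Surjective φ ∧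
        IsAdmissible (TwoSidedIdeal.ker φ) ∧
        (TwoSidedIdeal.ker φ).toSubspace K =
          Submodule.span K {x | ∃ (γ δ₁ δ₂ : StylicQuiver A)
            (p : Quiver.Path γ δ₁) (q : Quiver.Path γ δ₂),
            toStyl (columnWord γ * pathLabel p) = toStyl (columnWord γ * pathLabel q) ∧
            x = PathAlgebra.ofPath K p - PathAlgebra.ofPath K q} := by
  have := StylicQuiver.finite_stylAlgebra (K := K) (A := A)
  have := StylicQuiver.finite_hom (A := A)
  refine ⟨?_, StylicQuiver.pathHom K A, fun _ _ p => StylicQuiver.pathHom_ofPath p,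
    StylicQuiver.pathHom_surjective, StylicQuiver.isAdmissible_ker_pathHom,
    StylicQuiver.ker_pathHom⟩
  have h := isOrdinaryQuiver_of_isAdmissible (StylicQuiver.pathHom K A)
    StylicQuiver.pathHom_surjective StylicQuiver.isAdmissible_ker_pathHom
  have he : (fun v : StylicQuiver A => StylicQuiver.pathHom K A
      (PathAlgebra.ofPath K (Quiver.Path.nil : Quiver.Path v v))) = fun v => columnIdem K v :=
    funext fun v => StylicQuiver.pathHom_ofPath _
  rwa [he] at h
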